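/- Fix a set of concept names, one of which is a distinguished name $F$, and one transitive role $t$. An interpretation $\mathcal I$ over $t$ consists of a domain $\Delta^{\mathcal I}$, a set $A^{\mathcal I}\subseteq\Delta^{\mathcal I}$ for every concept name $A$, and a relation $t^{\mathcal I}\subseteq\Delta^{\mathcal I}\times\Delta^{\mathcal I}$; only finitely many concept names $A$ occur in $\mathcal I$ (that is, have $A^{\mathcal I}\neq\emptyset$). It is transitive if $t^{\mathcal I}$ is. Elements of $F^{\mathcal I}$ are called critical. A rooted $X$-labelled interpretation $(\mathcal I,a,\iota)$ has in addition a root $a\in\Delta^{\mathcal I}$ and a labelling $\iota:\Delta^{\mathcal I}\to X$. A homomorphism of rooted $X$-labelled interpretations preserves membership in concepts, $t$-edges, the root and labels. It is $t$-strong if $\mathrm{tp}(u)=\mathrm{tp}(h(u))$ and $\mathrm{rch}(u)=\mathrm{rch}(h(u))$ for every $u$ in its domain, where $\mathrm{tp}(u)$ is the set of concept names $A$ with $u\in A^{\mathcal I}$, and $\mathrm{rch}(u)$ is the set of concept names $A$ such that a nonempty $t$-path leads from $u$ to an element of $A^{\mathcal I}$. Quasi-unravelling. A critical cluster of $\mathcal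 I$ is a strongly connected component (SCC) with a critical element; $\Delta_F$ is the union of the critical clusters; $K_a$ is the SCC of $a$ if it is critical, and $\{a\}$ otherwise. The domain of the quasi-unravelling $(\widetilde{\mathcal I},a,\widetilde\iota)$ of $(\mathcal I,a,\iota)$ consists of $\Delta_F\cup\{a\}$ and of all pairs $(K,p)$ where $K$ is $K_a$ or a critical cluster, and $p$ is a nonempty path in $\mathcal I$ that begins in a $t$-successor of an element of $K$ and visits only elements outside $\Delta_F\cup\{a\}$. Elements of $\Delta_F\cup\{a\}$ keep their concepts and labels, and $(K,pu)$ inherits those of $u$. The role $t^{\widetilde{\mathcal I}}$ is the transitive closure of $t^{\mathcal I}\cap((\Delta_F\cup\{a\})\times\Delta_F)$ together with all edges $(u,(K,p))$ with $u\in K$, all edges $((K,p),(K,pu))$, and all edges $((K,pu),v)$ with $(u,v)\in t^{\mathcal I}$ and $v\in\Delta_F$. Elementary interpretations. A singleton is a single node without edges; a cycle is a simple directed cycle (of length at least $1$); an interpretation is a critical cluster if it is one SCC with a critical element. Unions of interpretations are taken componentwise. Loop trees are defined inductively: every rooted singleton is a loop tree; if $(\mathcal I,u)$ is a singleton or a cycle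 without critical elements, and $(\mathcal I_1,u_1),\dots,(\mathcal I_n,u_n)$ are loop trees that share only critical elements with each other and with $(\mathcal I,u)$, then the union of all of them with the additional edges $(u,u_1),\dots,(u,u_n)$ and with root $u$ is a loop tree. Elementary interpretations are defined inductively: (1) rooted critical clusters and loop trees are elementary; (2) if $(\mathcal I,u)$ is a loop tree and $(\mathcal I_1,u_1),\dots,(\mathcal I_n,u_n)$ are pairwise disjoint elementary interpretations such that $u_i$ is the only element shared by $\mathcal I$ and $\mathcal I_i$ and is critical in both, then $(\mathcal I\cup\mathcal I_1\cup\dots\cup\mathcal I_n,u)$ is elementary; (3) if $(\mathcal I,u)$ is a critical cluster, $(\mathcal J,v)$ is elementary without cycles visiting $v$, and $v$ is the only element shared by $\mathcal I$ and $\mathcal J$, then $(\mathcal I\cup\mathcal J,u)$ is elementary. A rooted $X$-labelled interpretation is elementary if the underlying rooted interpretation is. Theorem. Let $(\mathcal I,a,\iota)$ be a transitive rooted $X$-labelled interpretation over $t$ with finitely many critical elements, in which only finitely many labels are used (for instance, let $X$ be finite), and let $\ell$ be the number of concept names that occur in $\mathcal I$. Then there is an elementary rooted $X$-labelled interpretation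 $(\mathcal E,a,\epsilon)$ over $t$ with at most $(\ell+1)^{(\ell+1)^2}$ elements whose quasi-unravelling $(\widetilde{\mathcal E},a,\widetilde\epsilon)$ maps to $(\mathcal I,a,\iota)$ by a $t$-strong homomorphism. -/

import Mathlib

namespace DL

/-- An interpretation over one role `t`: a domain of elements taken from the universe `U`, an
interpretation of every concept name from `N`, and an interpretation of `t`
(all the other roles are empty). -/
structure Interp (N U : Type*) where
  dom : Set U
  concept : N → Set U
  role : U → U → Prop
  concept_sub : ∀ A, concept A ⊆ dom
  role_sub : ∀ x y, role x y → x ∈ dom ∧ y ∈ dom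

/-- A rooted interpretation. -/
structure Rooted (N U : Type*) extends Interp N U where
  root : U
  root_mem : root ∈ dom

/-- A rooted `X`-labelled interpretation; only the labels of elements of the domain matter. -/
structure Labelled (N U X : Type*) extends Rooted N U where
  label : U → X

namespace Interp

variable {N U : Type*} (I : Interp N U)

def IsTransitive : Prop := ∀ x y z, I.role x y → I.role y z → I.role x z

/-- The concept names that occur in `I`. -/
def occurring : Set N := {A | (I.concept A).Nonempty}

/-- The unary type of an element. -/
def type (u : U) : Set N := {A | u ∈ I.concept A}

/-- The concept names reachable from `u`, that is, those that hold at some element to which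
a nonempty `t`-path leads from `u`. -/
def rch (u : U) : Set N := {A | ∃ v ∈ I.concept A, Relation.TransGen I.role u v}

/-- The strongly connected component of `u`. -/
def cluster (u : U) : Set U :=
  {v | v ∈ I.dom ∧ Relation.ReflTransGen I.role u v ∧ Relation.ReflTransGen I.role v u}

/-- `K` is a critical cluster of `I`: a strongly connected component with a critical element,
where the critical elements are those of the concept `F`. -/
def IsCritCluster (F : N) (K : Set U) : Prop :=
  (∃ u ∈ I.dom, K = I.cluster u) ∧ (K ∩ I.concept F).Nonempty

/-- The union of all critical clusters. -/
def critPart (F : N) : Set U := {u | ∃ K, I.IsCritCluster F K ∧ u ∈ K}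

open Classical in
/-- The cluster of `a` if it is critical, and `{a}` otherwise. -/
noncomputable def clusterOrSelf (F : N) (a : U) : Set U :=
  if I.IsCritCluster F (I.cluster a) then I.cluster a else {a}

/-- `I` is a single isolated node. -/
def IsSingleton : Prop := (∃ u, I.dom = {u}) ∧ ∀ x y, ¬ I.role x y

/-- `I` is a simple directed cycle (a single node with a loop is a cycle of length one). -/
def IsCycle : Prop :=
  ∃ (n : ℕ) (c : Fin (n + 1) → U), Function.Injective c ∧ Set.range c = I.dom ∧
    ∀ x y, I.role x y ↔ ∃ i, x = c i ∧ y = c (i + 1)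

/-- `I` as a whole is one strongly connected component and has a critical element. -/
def IsWholeCritCluster (F : N) : Prop :=
  (∀ x ∈ I.dom, ∀ y ∈ I.dom, Relation.ReflTransGen I.role x y) ∧ (I.concept F).Nonempty

/-- All the elements shared by `I` and `J` are critical (in both of them). -/
def ShareOnlyCritical (F : N) (I J : Interp N U) : Prop :=
  I.dom ∩ J.dom ⊆ I.concept F ∩ J.concept F

end Interp

namespace Rooted

variable {N U : Type*}

/-- The union of `R` and all the `J i`, with the root of `R`. -/
def union (R : Rooted N U) {κ : Type} (J : κ → Rooted N U) : Rooted N U where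
  dom := R.dom ∪ ⋃ i, (J i).dom
  concept A := R.concept A ∪ ⋃ i, (J i).concept A
  role x y := R.role x y ∨ ∃ i, (J i).role x y
  concept_sub A := Set.union_subset_union (R.concept_sub A)
    (Set.iUnion_mono fun i => (J i).concept_sub A)
  role_sub := by
    rintro x y (h | ⟨i, h⟩)
    · exact ⟨Or.inl (R.role_sub x y h).1, Or.inl (R.role_sub x y h).2⟩
    · exact ⟨Or.inr (Set.mem_iUnion.2 ⟨i, ((J i).role_sub x y h).1⟩),
        Or.inr (Set.mem_iUnion.2 ⟨i, ((J i).role_sub x y h).2⟩)⟩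
  root := R.root
  root_mem := Or.inl R.root_mem

/-- The result of attaching all the `J i` to the root of `R`: the union, with additional
edges from the root of `R` to the roots of the `J i`. -/
def attach (R : Rooted N U) {κ : Type} (J : κ → Rooted N U) : Rooted N U where
  dom := (R.union J).dom
  concept := (R.union J).concept
  role x y := (R.union J).role x y ∨ (x = R.root ∧ ∃ i, y = (J i).root)
  concept_sub := (R.union J).concept_sub
  role_sub := by
    rintro x y (h | ⟨rfl, i, rfl⟩)
    · exact (R.union J).role_sub x y h
    · exact ⟨Or.inl R.root_mem, Or.inr (Set.mem_iUnion.2 ⟨i, (J i).root_mem⟩)⟩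
  root := R.root
  root_mem := Or.inl R.root_mem

end Rooted

inductive IsLoopTree {N U : Type*} (F : N) : Rooted N U → Prop
  | singleton (R : Rooted N U) : R.IsSingleton → IsLoopTree F R
  | attach (R : Rooted N U) (n : ℕ) (L : Fin n → Rooted N U) :
      (R.IsSingleton ∨ R.IsCycle) →
      R.concept F = ∅ →
      (∀ i, IsLoopTree F (L i)) →
      (∀ i j, i ≠ j → Interp.ShareOnlyCritical F (L i).toInterp (L j).toInterp) →
      (∀ i, Interp.ShareOnlyCritical F R.toInterp (L i).toInterp) →
      IsLoopTree F (R.attach L)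

inductive IsElementary {N U : Type*} (F : N) : Rooted N U → Prop
  | critCluster (R : Rooted N U) : R.IsWholeCritCluster F → IsElementary F R
  | loopTree (R : Rooted N U) : IsLoopTree F R → IsElementary F R
  | loopTreeUnion (R : Rooted N U) (n : ℕ) (E : Fin n → Rooted N U) :
      IsLoopTree F R →
      (∀ i, IsElementary F (E i)) →
      (∀ i j, i ≠ j → Disjoint (E i).dom (E j).dom) →
      (∀ i, R.dom ∩ (E i).dom = {(E i).root}) →
      (∀ i, (E i).root ∈ R.concept F ∧ (E i).root ∈ (E i).concept F) →
      IsElementary F (R.union E)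
  | critClusterUnion (R : Rooted N U) (E : Rooted N U) :
      R.IsWholeCritCluster F →
      IsElementary F E →
      ¬ Relation.TransGen E.role E.root E.root →
      R.dom ∩ E.dom = {E.root} →
      IsElementary F (R.union fun _ : Unit => E)

namespace Rooted

variable {N U : Type*} (F : N) (R : Rooted N U)

/-- The elements of `R` of which only one copy is kept in the quasi-unravelling. -/
def kept : Set U := R.critPart F ∪ {R.root}

/-- The elements of the quasi-unravelling: `Sum.inl u` is the copy of a kept element `u`, and
`Sum.inr (K, p)` is the pair of a cluster `K` and a nonempty path `p`. -/
def IsQuNode : U ⊕ (Set U × List U) → Prop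
  | Sum.inl u => u ∈ R.kept F
  | Sum.inr (K, p) =>
      (K = R.clusterOrSelf F R.root ∨ R.IsCritCluster F K) ∧
      List.IsChain R.role p ∧
      (∃ k ∈ K, ∃ u ∈ p.head?, R.role k u) ∧
      ∀ u ∈ p, u ∈ R.dom \ R.kept F

/-- The element of `R` of which an element of the quasi-unravelling is a copy
(paths are nonempty, so that the default value of `getLastD` is not used). -/
def quOrigin : U ⊕ (Set U × List U) → U
  | Sum.inl u => u
  | Sum.inr (_, p) => p.getLastD R.root

/-- The edges of which the role of the quasi-unravelling is the transitive closure. -/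
inductive QuEdge : U ⊕ (Set U × List U) → U ⊕ (Set U × List U) → Prop
  | single (u v : U) : u ∈ R.kept F → v ∈ R.critPart F → R.role u v →
      QuEdge (Sum.inl u) (Sum.inl v)
  | enter (u : U) (K : Set U) (p : List U) : R.IsQuNode F (Sum.inr (K, p)) → u ∈ K →
      QuEdge (Sum.inl u) (Sum.inr (K, p))
  | step (K : Set U) (p : List U) (u : U) : R.IsQuNode F (Sum.inr (K, p)) →
      R.IsQuNode F (Sum.inr (K, p ++ [u])) →
      QuEdge (Sum.inr (K, p)) (Sum.inr (K, p ++ [u]))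
  | leave (K : Set U) (p : List U) (u v : U) : R.IsQuNode F (Sum.inr (K, p ++ [u])) →
      R.role u v → v ∈ R.critPart F →
      QuEdge (Sum.inr (K, p ++ [u])) (Sum.inl v)

variable {F R} in
theorem QuEdge.isQuNode {x y : U ⊕ (Set U × List U)} (h : R.QuEdge F x y) :
    R.IsQuNode F x ∧ R.IsQuNode F y := by
  cases h with
  | single u v hu hv _ => exact ⟨hu, Or.inl hv⟩
  | enter u K p hp hu =>
    refine ⟨?_, hp⟩
    rcases hp.1 with rfl | hK
    · unfold Interp.clusterOrSelf at hu
      split_ifs at hu with hc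
      · exact Or.inl ⟨_, hc, hu⟩
      · exact Or.inr hu
    · exact Or.inl ⟨K, hK, hu⟩
  | step K p u hp hpu => exact ⟨hp, hpu⟩
  | leave K p u v hp _ hv => exact ⟨hp, Or.inl hv⟩

/-- The quasi-unravelling of a rooted interpretation. -/
def quasiUnravelling : Rooted N (U ⊕ (Set U × List U)) where
  dom := {x | R.IsQuNode F x}
  concept A := {x | R.IsQuNode F x ∧ R.quOrigin x ∈ R.concept A}
  role := Relation.TransGen (R.QuEdge F)
  concept_sub _ _ hx := hx.1
  role_sub x y h := by
    refine ⟨?_, ?_⟩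
    · obtain ⟨z, hz, -⟩ := Relation.TransGen.head'_iff.1 h
      exact hz.isQuNode.1
    · obtain ⟨z, -, hz⟩ := Relation.TransGen.tail'_iff.1 h
      exact hz.isQuNode.2
  root := Sum.inl R.root
  root_mem := Or.inr rfl

end Rooted

/-- The quasi-unravelling of a rooted labelled interpretation. -/
def Labelled.quasiUnravelling {N U X : Type*} (F : N) (E : Labelled N U X) :
    Labelled N (U ⊕ (Set U × List U)) X where
  toRooted := E.toRooted.quasiUnravelling F
  label x := E.label (E.toRooted.quOrigin x)

/-- `h` is a homomorphism of rooted labelled interpretations. -/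
structure IsHom {N U V X : Type*} (I : Labelled N U X) (J : Labelled N V X) (h : U → V) :
    Prop where
  map_dom : ∀ x ∈ I.dom, h x ∈ J.dom
  map_concept : ∀ A, ∀ x ∈ I.concept A, h x ∈ J.concept A
  map_role : ∀ x y, I.role x y → J.role (h x) (h y)
  map_root : h I.root = J.root
  map_label : ∀ x ∈ I.dom, I.label x = J.label (h x)

/-- `h` is a `t`-strong homomorphism of rooted labelled interpretations. -/
structure IsStrongHom {N U V X : Type*} (I : Labelled N U X) (J : Labelled N V X)
    (h : U → V) : Prop extends IsHom I J h where
  type_eq : ∀ x ∈ I.dom, I.type x = J.type (h x)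
  rch_eq : ∀ x ∈ I.dom, I.rch x = J.rch (h x)

end DL

/-!
A strong homomorphism has to preserve the type, the label and the set of reachable concept names of
every element, and the last of these can only shrink along `t`-edges. The proof is an induction on
the number of reachable concept names, which constructs tree-shaped patterns: an elementary interpretation together with a simulation relation `sim` that says which elements of `I`
realize which of its elements. Elements of critical clusters must have a unique realizer, because
the quasi-unravelling keeps one copy of them; all other elements may have many realizers, because
the quasi-unravelling follows paths through them. For a realizable pattern, a strong homomorphism
is obtained by following the simulation along paths (`Pattern.IsRealizable.exists_isStrongHom`).

The induction needs a uniform statement (`HasCover`): finitely many patterns suffice for all elements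
with fewer than `t` reachable concept names. This makes it possible to colour every element by its
type, its label and the smaller patterns available at its successors, with finitely many colours.
Among the successors of `u` from which the same set `S` of concept names is reachable, there
is a stable one, below which the set of colours still ahead no longer changes (`exists_isStable`).
Let `S₁` be the set of concept names in the types of these colours.

* If `S₁` is empty, then every `A ∈ S` is witnessed by a successor with fewer reachable names, and
  the smaller patterns are attached to a single node for `u`.
* If `S₁` contains the critical name, then some critical element lies in a bottom cluster among
  the elements from which `S` is reachable (here finiteness of the set of critical elements is used).
  The node for `u` gets a successor cluster made of witnesses from that cluster.
* Otherwise each `A ∈ S₁` has a colour that recurs for ever, and the node for `u` gets as a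
  successor a noncritical cycle with one element for each of them; its unravelling is followed in `I`
  by stable elements of the required colours.

In the last two cases the smaller patterns for `S \ S₁` are attached to the cluster or cycle.
All parts are kept disjoint by splitting an infinite supply of names. A pattern has at most
`b (t + 1) = 1 + ℓ + ℓ * b t` elements, which is well below the bound claimed.
-/

namespace DL

/-! ### Critical clusters -/

theorem Interp.mem_dom_of_reflTransGen {N U : Type*} {I : Interp N U} {u v : U} (hu : u ∈ I.dom)
    (h : Relation.ReflTransGen I.role u v) : v ∈ I.dom := by
  rcases Relation.ReflTransGen.cases_tail h with rfl | ⟨w, -, hw⟩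
  · exact hu
  · exact (I.role_sub _ _ hw).2

theorem Interp.mem_critPart {N U : Type*} {I : Interp N U} {F : N} {u : U} :
    u ∈ I.critPart F ↔ ∃ f ∈ I.concept F,
      Relation.ReflTransGen I.role u f ∧ Relation.ReflTransGen I.role f u := by
  constructor
  · rintro ⟨K, ⟨⟨x, -, rfl⟩, f, hf, hfF⟩, hu⟩
    exact ⟨f, hfF, hu.2.2.trans hf.2.1, hf.2.2.trans hu.2.1⟩
  · rintro ⟨f, hf, h1, h2⟩
    have hfd := I.concept_sub F hf
    exact ⟨I.cluster f, ⟨⟨f, hfd, rfl⟩, f, ⟨hfd, .refl, .refl⟩, hf⟩,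
      Interp.mem_dom_of_reflTransGen hfd h2, h2, h1⟩

theorem Interp.critPart_subset_dom {N U : Type*} {I : Interp N U} {F : N} {u : U}
    (h : u ∈ I.critPart F) : u ∈ I.dom := by
  obtain ⟨K, ⟨⟨x, -, rfl⟩, -⟩, hu⟩ := h
  exact hu.1

theorem Interp.isCritCluster_cluster {N U : Type*} {I : Interp N U} {F : N} {u : U}
    (h : u ∈ I.critPart F) : I.IsCritCluster F (I.cluster u) ∧ u ∈ I.cluster u := by
  have hu := Interp.critPart_subset_dom h
  obtain ⟨f, hf, h1, h2⟩ := Interp.mem_critPart.1 h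
  exact ⟨⟨⟨u, hu, rfl⟩, f, ⟨I.concept_sub F hf, h1, h2⟩, hf⟩, hu, .refl, .refl⟩

theorem Interp.IsCritCluster.reach {N U : Type*} {I : Interp N U} {F : N} {K : Set U}
    (h : I.IsCritCluster F K) {k l : U} (hk : k ∈ K) (hl : l ∈ K) :
    Relation.ReflTransGen I.role k l := by
  obtain ⟨⟨x, -, rfl⟩, -⟩ := h
  exact hk.2.2.trans hl.2.1

theorem Interp.IsCritCluster.subset_critPart {N U : Type*} {I : Interp N U} {F : N} {K : Set U}
    (h : I.IsCritCluster F K) {k : U} (hk : k ∈ K) : k ∈ I.critPart F := ⟨K, h, hk⟩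

theorem Interp.IsTransitive.role_of_transGen {N U : Type*} {I : Interp N U} (h : I.IsTransitive)
    {u v : U} (huv : Relation.TransGen I.role u v) : I.role u v := by
  induction huv with
  | single h1 => exact h1
  | tail _ h1 ih => exact h _ _ _ ih h1

theorem Interp.IsTransitive.mem_rch {N U : Type*} {I : Interp N U} (h : I.IsTransitive) {u : U}
    {A : N} : A ∈ I.rch u ↔ ∃ v ∈ I.concept A, I.role u v :=
  ⟨fun ⟨v, hv, huv⟩ => ⟨v, hv, h.role_of_transGen huv⟩, fun ⟨v, hv, huv⟩ => ⟨v, hv, .single huv⟩⟩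

theorem Interp.IsTransitive.rch_subset {N U : Type*} {I : Interp N U} (h : I.IsTransitive)
    {u v : U} (huv : I.role u v) : I.rch v ⊆ I.rch u := by
  intro A hA
  obtain ⟨w, hw, hvw⟩ := h.mem_rch.1 hA
  exact h.mem_rch.2 ⟨w, hw, h _ _ _ huv hvw⟩

theorem Interp.rch_subset_occurring {N U : Type*} {I : Interp N U} (u : U) :
    I.rch u ⊆ I.occurring := fun _ ⟨v, hv, _⟩ => ⟨v, hv⟩

theorem Interp.type_subset_occurring {N U : Type*} {I : Interp N U} (u : U) :
    I.type u ⊆ I.occurring := fun _ h => ⟨u, h⟩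

theorem Rooted.reach_of_mem_clusterOrSelf {N U : Type*} {F : N} {R : Rooted N U} {K : Set U}
    (hK : K = R.clusterOrSelf F R.root ∨ R.IsCritCluster F K) {k l : U} (hk : k ∈ K) (hl : l ∈ K) :
    k = l ∨ (l ∈ R.critPart F ∧ Relation.TransGen R.role k l) := by
  have key : R.IsCritCluster F K →
      k = l ∨ (l ∈ R.critPart F ∧ Relation.TransGen R.role k l) := by
    intro h
    rcases Relation.reflTransGen_iff_eq_or_transGen.1 (h.reach hk hl) with h1 | h1
    · exact Or.inl h1.symm
    · exact Or.inr ⟨h.subset_critPart hl, h1⟩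
  rcases hK with hK | hK
  · unfold Interp.clusterOrSelf at hK
    split_ifs at hK with hc
    · subst hK
      exact key hc
    · subst hK
      exact Or.inl (Eq.trans hk (Eq.symm hl))
  · exact key hK

theorem Rooted.subset_kept {N U : Type*} {F : N} {R : Rooted N U} {K : Set U}
    (hK : K = R.clusterOrSelf F R.root ∨ R.IsCritCluster F K) {k : U} (hk : k ∈ K) :
    k ∈ R.kept F := by
  rcases hK with hK | hK
  · unfold Interp.clusterOrSelf at hK
    split_ifs at hK with hc
    · subst hK
      exact Or.inl (hc.subset_critPart hk)
    · subst hK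
      exact Or.inr hk
  · exact Or.inl (hK.subset_critPart hk)

theorem Rooted.exists_cluster_of_mem_kept {N U : Type*} {F : N} {R : Rooted N U} {u : U}
    (hu : u ∈ R.kept F) :
    ∃ K, (K = R.clusterOrSelf F R.root ∨ R.IsCritCluster F K) ∧ u ∈ K := by
  by_cases hc : u ∈ R.critPart F
  · exact ⟨_, Or.inr (Interp.isCritCluster_cluster hc).1, (Interp.isCritCluster_cluster hc).2⟩
  · rcases hu with hu | hu
    · exact absurd hu hc
    · refine ⟨_, Or.inl rfl, ?_⟩
      unfold Interp.clusterOrSelf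
      split_ifs with h
      · exact ⟨(show u = R.root from hu) ▸ R.root_mem, hu ▸ .refl, hu ▸ .refl⟩
      · exact hu

/-! ### Paths in the quasi-unravelling -/

theorem Rooted.isQuNode_singleton {N U : Type*} {F : N} {R : Rooted N U} {K : Set U} {k u : U}
    (hK : K = R.clusterOrSelf F R.root ∨ R.IsCritCluster F K) (hk : k ∈ K) (hku : R.role k u)
    (hu : u ∉ R.kept F) : R.IsQuNode F (Sum.inr (K, [u])) := by
  refine ⟨hK, by simp, ⟨k, hk, u, by simp, hku⟩, ?_⟩
  intro v hv
  obtain rfl := List.mem_singleton.1 hv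
  exact ⟨(R.role_sub _ _ hku).2, hu⟩

theorem Rooted.isQuNode_append {N U : Type*} {F : N} {R : Rooted N U} {K : Set U} {p : List U}
    {u v : U} : R.IsQuNode F (Sum.inr (K, p ++ [u] ++ [v])) ↔
      R.IsQuNode F (Sum.inr (K, p ++ [u])) ∧ R.role u v ∧ v ∉ R.kept F := by
  have hhead : (p ++ [u] ++ [v]).head? = (p ++ [u]).head? := by cases p <;> simp
  constructor
  · rintro ⟨hK, hch, hst, hm⟩
    rw [List.isChain_append] at hch
    rw [hhead] at hst
    refine ⟨⟨hK, hch.1, hst, fun w hw => hm w (by simp at hw ⊢; tauto)⟩, ?_, (hm v (by simp)).2⟩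
    exact hch.2.2 u (by simp) v (by simp)
  · rintro ⟨⟨hK, hch, hst, hm⟩, huv, hv⟩
    refine ⟨hK, ?_, by rw [hhead]; exact hst, ?_⟩
    · rw [List.isChain_append]
      refine ⟨hch, by simp, ?_⟩
      intro x hx y hy
      simp at hx hy
      subst hx hy
      exact huv
    · intro w hw
      rcases List.mem_append.1 hw with hw | hw
      · exact hm w hw
      · obtain rfl := List.mem_singleton.1 hw
        exact ⟨(R.role_sub _ _ huv).2, hv⟩

theorem Rooted.IsQuNode.exists_eq_append {N U : Type*} {F : N} {R : Rooted N U} {K : Set U}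
    {p : List U} (h : R.IsQuNode F (Sum.inr (K, p))) : ∃ q u, p = q ++ [u] := by
  rcases List.eq_nil_or_concat' p with rfl | ⟨q, u, rfl⟩
  · obtain ⟨-, -, ⟨k, -, u, hu, -⟩, -⟩ := h
    simp at hu
  · exact ⟨q, u, rfl⟩

@[simp] theorem Rooted.quOrigin_append {N U : Type*} {R : Rooted N U} {K : Set U} {p : List U}
    {u : U} : R.quOrigin (Sum.inr (K, p ++ [u])) = u := by
  simp [Rooted.quOrigin]

/-- Every edge of `R` lifts to the quasi-unravelling, unless it ends in a root that lies in no
critical cluster: edges into such a root are lost. -/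
theorem Rooted.exists_quEdge {N U : Type*} {F : N} {R : Rooted N U}
    (hin : R.root ∉ R.critPart F → ∀ x, ¬ R.role x R.root) {x : U ⊕ (Set U × List U)}
    (hx : R.IsQuNode F x) {v : U} (hv : R.role (R.quOrigin x) v) :
    ∃ y, R.QuEdge F x y ∧ R.quOrigin y = v := by
  by_cases hc : v ∈ R.critPart F
  · refine ⟨Sum.inl v, ?_, rfl⟩
    rcases x with u | ⟨K, p⟩
    · exact .single u v hx hc hv
    · obtain ⟨q, u, rfl⟩ := hx.exists_eq_append
      rw [Rooted.quOrigin_append] at hv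
      exact .leave K q u v hx hv hc
  · have hk : v ∉ R.kept F := by
      rintro (h | h)
      · exact hc h
      · obtain rfl : v = R.root := h
        exact hin hc _ hv
    rcases x with u | ⟨K, p⟩
    · obtain ⟨K, hK, huK⟩ := Rooted.exists_cluster_of_mem_kept (show u ∈ R.kept F from hx)
      exact ⟨_, .enter u K [v] (Rooted.isQuNode_singleton hK huK hv hk) huK, rfl⟩
    · obtain ⟨q, u, rfl⟩ := hx.exists_eq_append
      rw [Rooted.quOrigin_append] at hv
      exact ⟨_, .step K _ v hx (Rooted.isQuNode_append.2 ⟨hx, hv, hk⟩), Rooted.quOrigin_append⟩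

theorem Rooted.rch_subset_rch_quasiUnravelling {N U : Type*} {F : N} {R : Rooted N U}
    (hin : R.root ∉ R.critPart F → ∀ x, ¬ R.role x R.root) {x : U ⊕ (Set U × List U)}
    (hx : R.IsQuNode F x) : R.rch (R.quOrigin x) ⊆ (R.quasiUnravelling F).rch x := by
  rintro A ⟨v, hvA, hv⟩
  suffices h : ∃ y, Relation.TransGen (R.QuEdge F) x y ∧ R.quOrigin y = v by
    obtain ⟨y, hxy, rfl⟩ := h
    obtain ⟨z, -, hz⟩ := Relation.TransGen.tail'_iff.1 hxy
    exact ⟨y, ⟨hz.isQuNode.2, hvA⟩, .single hxy⟩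
  clear hvA
  induction hv with
  | single h =>
    obtain ⟨y, hy, rfl⟩ := Rooted.exists_quEdge hin hx h
    exact ⟨y, .single hy, rfl⟩
  | tail _ h ih =>
    obtain ⟨y, hy, rfl⟩ := ih
    obtain ⟨w, -, hw⟩ := Relation.TransGen.tail'_iff.1 hy
    obtain ⟨z, hz, rfl⟩ := Rooted.exists_quEdge hin hw.isQuNode.2 h
    exact ⟨z, hy.tail hz, rfl⟩

/-! ### Patterns and their realizations -/

/-- A rooted interpretation `base` together with a relation `sim` between its elements and those
of another interpretation; `sim e w` is read as `w` realizes `e`. -/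
structure Pattern (N U : Type*) where
  base : Rooted N U
  sim : U → U → Prop

/-- The pattern `P` is realizable in `I`: the relation `P.sim` is a simulation of `P.base` by `I`
that preserves types and reachable concept names. All realizers of an element carry the same
label, and elements of critical clusters, of which the quasi-unravelling keeps a single copy,
have a single realizer. -/
structure Pattern.IsRealizable {N U X : Type*} (F : N) (I : Labelled N U X) (P : Pattern N U) :
    Prop where
  mem : ∀ {e w}, P.sim e w → e ∈ P.base.dom ∧ w ∈ I.dom
  total : ∀ {e}, e ∈ P.base.dom → ∃ w, P.sim e w
  type_eq : ∀ {e w}, P.sim e w → P.base.type e = I.type w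
  label_eq : ∀ {e w w'}, P.sim e w → P.sim e w' → I.label w = I.label w'
  rch_sub : ∀ {e w}, P.sim e w → I.rch w ⊆ P.base.rch e
  crit_eq : ∀ {e w w'}, e ∈ P.base.critPart F → P.sim e w → P.sim e w' → w = w'
  step : ∀ {e w e'}, P.sim e w → P.base.role e e' → ∃ w', I.role w w' ∧ P.sim e' w'

theorem Pattern.IsRealizable.exists_of_transGen {N U X : Type*} {F : N} {I : Labelled N U X}
    {P : Pattern N U} (hP : P.IsRealizable F I) (htrans : I.IsTransitive) {e e' w : U}
    (hw : P.sim e w) (h : Relation.TransGen P.base.role e e') :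
    ∃ w', I.role w w' ∧ P.sim e' w' := by
  induction h with
  | single h => exact hP.step hw h
  | tail _ h ih =>
    obtain ⟨w', h1, h2⟩ := ih
    obtain ⟨w'', h3, h4⟩ := hP.step h2 h
    exact ⟨w'', htrans _ _ _ h1 h3, h4⟩

/-- A realizable pattern whose root is realized by the root of `I` gives a strong homomorphism
from the quasi-unravelling: kept elements go to a fixed realizer, and the image of a path is
computed along the path by means of the simulation. -/
theorem Pattern.IsRealizable.exists_isStrongHom {N U X : Type*} {F : N} {I : Labelled N U X}
    {P : Pattern N U} (hP : P.IsRealizable F I) (htrans : I.IsTransitive)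
    (hroot : P.sim P.base.root I.root)
    (hin : P.base.root ∉ P.base.critPart F → ∀ x, ¬ P.base.role x P.base.root) :
    ∃ (label : U → X) (h : U ⊕ (Set U × List U) → U),
      IsStrongHom (Labelled.quasiUnravelling F ⟨P.base, label⟩) I h := by
  classical
  obtain ⟨E, sim⟩ := P
  dsimp only at hroot hin ⊢
  have hg : ∃ g : U → U, g E.root = I.root ∧ ∀ e ∈ E.dom, sim e (g e) := by
    have : ∀ e, ∃ w, (e = E.root → w = I.root) ∧ (e ∈ E.dom → sim e w) := by
      intro e
      by_cases he : e = E.root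
      · exact ⟨I.root, fun _ => rfl, fun _ => he ▸ hroot⟩
      · by_cases hd : e ∈ E.dom
        · obtain ⟨w, hw⟩ := hP.total hd
          exact ⟨w, fun h => absurd h he, fun _ => hw⟩
        · exact ⟨e, fun h => absurd h he, fun h => absurd h hd⟩
    choose g hg1 hg2 using this
    exact ⟨g, hg1 _ rfl, hg2⟩
  obtain ⟨g, hgroot, hg⟩ := hg
  have hkept : ∀ {e}, e ∈ E.kept F → sim e (g e) := by
    rintro e (he | he)
    · exact hg e (Interp.critPart_subset_dom he)
    · exact hg e ((show e = E.root from he) ▸ E.root_mem)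
  -- The next realizer along a path, and the realizer of the first element of a path.
  have hnxt : ∃ nxt : U → U → U, ∀ e w e', sim e w → E.role e e' →
      I.role w (nxt w e') ∧ sim e' (nxt w e') := by
    have : ∀ w e', ∃ w', ∀ e, sim e w → E.role e e' → I.role w w' ∧ sim e' w' := by
      intro w e'
      by_cases h : ∃ e, sim e w ∧ E.role e e'
      · obtain ⟨e, h1, h2⟩ := h
        obtain ⟨w', h3⟩ := hP.step h1 h2
        exact ⟨w', fun _ _ _ => h3⟩
      · exact ⟨w, fun e h1 h2 => absurd ⟨e, h1, h2⟩ h⟩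
    choose nxt h using this
    exact ⟨nxt, fun e w e' => h w e' e⟩
  obtain ⟨nxt, hnxt⟩ := hnxt
  have hst : ∃ st : Set U → U → U, ∀ K u,
      (K = E.clusterOrSelf F E.root ∨ E.IsCritCluster F K) → (∃ k ∈ K, E.role k u) →
      sim u (st K u) ∧ ∀ k ∈ K, I.role (g k) (st K u) := by
    have : ∀ K u, ∃ w, (K = E.clusterOrSelf F E.root ∨ E.IsCritCluster F K) →
        (∃ k ∈ K, E.role k u) → sim u w ∧ ∀ k ∈ K, I.role (g k) w := by
      intro K u
      by_cases hK : K = E.clusterOrSelf F E.root ∨ E.IsCritCluster F K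
      · by_cases hk : ∃ k ∈ K, E.role k u
        · obtain ⟨l, hl, hlu⟩ := hk
          obtain ⟨w, hw1, hw2⟩ := hP.step (hkept (Rooted.subset_kept hK hl)) hlu
          refine ⟨w, fun _ _ => ⟨hw2, fun k hk => ?_⟩⟩
          rcases Rooted.reach_of_mem_clusterOrSelf hK hk hl with rfl | ⟨hlc, hkl⟩
          · exact hw1
          · obtain ⟨w', h1, h2⟩ :=
              hP.exists_of_transGen htrans (hkept (Rooted.subset_kept hK hk)) hkl
            obtain rfl := hP.crit_eq hlc h2 (hg l (Interp.critPart_subset_dom hlc))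
            exact htrans _ _ _ h1 hw1
        · exact ⟨u, fun _ h => absurd h hk⟩
      · exact ⟨u, fun h => absurd h hK⟩
    choose st h using this
    exact ⟨st, h⟩
  obtain ⟨st, hst⟩ := hst
  let hp : Set U → List U → U := fun K p =>
    match p with
    | [] => I.root
    | u :: q => q.foldl nxt (st K u)
  have hp_append : ∀ K p u v, hp K (p ++ [u] ++ [v]) = nxt (hp K (p ++ [u])) v := by
    intro K p u v
    cases p <;> simp [hp, List.foldl_append]
  have hp_spec : ∀ K p u, E.IsQuNode F (Sum.inr (K, p ++ [u])) →
      sim u (hp K (p ++ [u])) ∧ ∀ k ∈ K, I.role (g k) (hp K (p ++ [u])) := by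
    intro K p
    induction p using List.reverseRecOn with
    | nil =>
      rintro u ⟨hK, -, ⟨k, hk, v, hv, hkv⟩, -⟩
      simp at hv
      subst hv
      exact hst K u hK ⟨k, hk, hkv⟩
    | append_singleton p v ih =>
      intro u h
      rw [Rooted.isQuNode_append] at h
      obtain ⟨h1, h2⟩ := ih v h.1
      obtain ⟨h3, h4⟩ := hnxt v _ u h1 h.2.1
      rw [hp_append]
      exact ⟨h4, fun k hk => htrans _ _ _ (h2 k hk) h3⟩
  let h : U ⊕ (Set U × List U) → U := fun x =>
    match x with
    | Sum.inl u => g u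
    | Sum.inr (K, p) => hp K p
  have hsim : ∀ x, E.IsQuNode F x → sim (E.quOrigin x) (h x) := by
    rintro (u | ⟨K, p⟩) hx
    · exact hkept hx
    · obtain ⟨q, u, rfl⟩ := hx.exists_eq_append
      rw [Rooted.quOrigin_append]
      exact (hp_spec K q u hx).1
  have hcrit : ∀ {e w v}, sim e w → E.role e v → v ∈ E.critPart F → I.role w (g v) := by
    intro e w v h1 h2 h3
    obtain ⟨w', h4, h5⟩ := hP.step h1 h2
    obtain rfl := hP.crit_eq h3 h5 (hg v (Interp.critPart_subset_dom h3))
    exact h4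
  have hedge : ∀ x y, E.QuEdge F x y → I.role (h x) (h y) := by
    intro x y hxy
    cases hxy with
    | single u v hu hv huv => exact hcrit (hkept hu) huv hv
    | enter u K p hK hu =>
      obtain ⟨q, v, rfl⟩ := hK.exists_eq_append
      exact (hp_spec K q v hK).2 u hu
    | step K p u h1 h2 =>
      obtain ⟨q, v, rfl⟩ := h1.exists_eq_append
      change I.role (hp K _) (hp K _)
      rw [hp_append]
      exact (hnxt v _ u (hp_spec K q v h1).1 (Rooted.isQuNode_append.1 h2).2.1).1
    | leave K p u v h1 h2 h3 => exact hcrit (hp_spec K p u h1).1 h2 h3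
  have hrole : ∀ x y, Relation.TransGen (E.QuEdge F) x y → I.role (h x) (h y) := by
    intro x y hxy
    induction hxy with
    | single h1 => exact hedge _ _ h1
    | tail _ h1 ih => exact htrans _ _ _ ih (hedge _ _ h1)
  have htype : ∀ x, E.IsQuNode F x → ∀ A, E.quOrigin x ∈ E.concept A ↔ h x ∈ I.concept A := by
    intro x hx A
    exact Set.ext_iff.1 (hP.type_eq (hsim x hx)) A
  refine ⟨fun e => I.label (g e), h, ⟨?_, ?_, ?_, ?_, ?_⟩, ?_, ?_⟩
  · exact fun x hx => (hP.mem (hsim x hx)).2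
  · exact fun A x hx => (htype x hx.1 A).1 hx.2
  · exact hrole
  · exact hgroot
  · exact fun x hx => hP.label_eq (hg _ (hP.mem (hsim x hx)).1) (hsim x hx)
  · intro x hx
    ext A
    exact ⟨fun h1 => (htype x hx A).1 h1.2, fun h1 => ⟨hx, (htype x hx A).2 h1⟩⟩
  · intro x hx
    apply Set.Subset.antisymm
    · rintro A ⟨y, hy, hxy⟩
      have hxy' : Relation.TransGen (E.QuEdge F) x y := by
        clear hy
        induction hxy with
        | single h1 => exact h1
        | tail _ h1 ih => exact ih.trans h1
      exact ⟨h y, (htype y hy.1 A).1 hy.2, .single (hrole _ _ hxy')⟩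
    · exact (hP.rch_sub (hsim x hx)).trans (Rooted.rch_subset_rch_quasiUnravelling hin hx)

/-! ### Attaching elementary interpretations -/

theorem Rooted.eq_of_fields {N U : Type*} {R S : Rooted N U} (hd : ∀ x, x ∈ R.dom ↔ x ∈ S.dom)
    (hc : ∀ A x, x ∈ R.concept A ↔ x ∈ S.concept A) (hr : ∀ x y, R.role x y ↔ S.role x y)
    (ho : R.root = S.root) : R = S := by
  obtain ⟨⟨d, c, r, _, _⟩, o, _⟩ := R
  obtain ⟨⟨d', c', r', _, _⟩, o', _⟩ := S
  obtain rfl : d = d' := Set.ext hd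
  obtain rfl : c = c' := funext fun A => Set.ext (hc A)
  obtain rfl : r = r' := funext fun x => funext fun y => propext (hr x y)
  obtain rfl : o = o' := ho
  rfl

theorem Rooted.mem_attach_dom {N U : Type*} {R : Rooted N U} {κ : Type} {L : κ → Rooted N U}
    {x : U} : x ∈ (R.attach L).dom ↔ x ∈ R.dom ∨ ∃ i, x ∈ (L i).dom := by
  simp [Rooted.attach, Rooted.union]

theorem Rooted.mem_attach_concept {N U : Type*} {R : Rooted N U} {κ : Type} {L : κ → Rooted N U}
    {A : N} {x : U} :
    x ∈ (R.attach L).concept A ↔ x ∈ R.concept A ∨ ∃ i, x ∈ (L i).concept A := by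
  simp [Rooted.attach, Rooted.union]

theorem Rooted.attach_role {N U : Type*} {R : Rooted N U} {κ : Type} {L : κ → Rooted N U}
    {x y : U} : (R.attach L).role x y ↔
      (R.role x y ∨ ∃ i, (L i).role x y) ∨ (x = R.root ∧ ∃ i, y = (L i).root) := Iff.rfl

theorem Rooted.mem_union_dom {N U : Type*} {R : Rooted N U} {κ : Type} {L : κ → Rooted N U}
    {x : U} : x ∈ (R.union L).dom ↔ x ∈ R.dom ∨ ∃ i, x ∈ (L i).dom := by
  simp [Rooted.union]

theorem Rooted.mem_union_concept {N U : Type*} {R : Rooted N U} {κ : Type} {L : κ → Rooted N U}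
    {A : N} {x : U} :
    x ∈ (R.union L).concept A ↔ x ∈ R.concept A ∨ ∃ i, x ∈ (L i).concept A := by
  simp [Rooted.union]

theorem Rooted.union_role {N U : Type*} {R : Rooted N U} {κ : Type} {L : κ → Rooted N U}
    {x y : U} : (R.union L).role x y ↔ (R.role x y ∨ ∃ i, (L i).role x y) := Iff.rfl

/-- `E` arises from a loop tree by attaching pairwise disjoint elementary interpretations at
critical elements. Unlike elementary interpretations in general, these can again be
attached to noncritical singletons and cycles. -/
def HasLoopTreeTop {N U : Type*} (F : N) (E : Rooted N U) : Prop :=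
  ∃ (R : Rooted N U) (n : ℕ) (L : Fin n → Rooted N U), IsLoopTree F R ∧
    (∀ i, IsElementary F (L i)) ∧ (∀ i j, i ≠ j → Disjoint (L i).dom (L j).dom) ∧
    (∀ i, R.dom ∩ (L i).dom = {(L i).root}) ∧
    (∀ i, (L i).root ∈ R.concept F ∧ (L i).root ∈ (L i).concept F) ∧ E = R.union L

theorem HasLoopTreeTop.isElementary {N U : Type*} {F : N} {E : Rooted N U}
    (h : HasLoopTreeTop F E) : IsElementary F E := by
  obtain ⟨R, n, L, h1, h2, h3, h4, h5, rfl⟩ := h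
  exact .loopTreeUnion R n L h1 h2 h3 h4 h5

/-- The rooted singleton `u` whose type is `T`. -/
def Rooted.point {N U : Type*} (u : U) (T : Set N) : Rooted N U where
  dom := {u}
  concept A := {x | x = u ∧ A ∈ T}
  role _ _ := False
  concept_sub _ _ hx := hx.1
  role_sub _ _ h := h.elim
  root := u
  root_mem := rfl

theorem Rooted.isSingleton_point {N U : Type*} (u : U) (T : Set N) :
    (Rooted.point u T).IsSingleton := ⟨⟨u, rfl⟩, fun _ _ h => h⟩

theorem IsElementary.hasLoopTreeTop {N U : Type*} {F : N} {E : Rooted N U}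
    (h : IsElementary F E) (hF : E.root ∈ E.concept F) : HasLoopTreeTop F E := by
  refine ⟨Rooted.point E.root {A | E.root ∈ E.concept A}, 1, fun _ => E,
    .singleton _ (Rooted.isSingleton_point _ _), fun _ => h,
    fun i j hij => absurd (Subsingleton.elim i j) hij, fun _ => ?_, fun _ => ⟨⟨rfl, hF⟩, hF⟩, ?_⟩
  · exact Set.inter_eq_left.2 (Set.singleton_subset_iff.2 E.root_mem)
  · refine Rooted.eq_of_fields (fun x => ?_) (fun A x => ?_) (fun x y => ?_) rfl
    · rw [Rooted.mem_union_dom]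
      refine ⟨fun hx => Or.inr ⟨0, hx⟩, ?_⟩
      rintro (hx | ⟨-, hx⟩)
      · exact (show x = E.root from hx) ▸ E.root_mem
      · exact hx
    · rw [Rooted.mem_union_concept]
      refine ⟨fun hx => Or.inr ⟨0, hx⟩, ?_⟩
      rintro (⟨rfl, hx⟩ | ⟨-, hx⟩)
      · exact hx
      · exact hx
    · rw [Rooted.union_role]
      refine ⟨fun hx => Or.inr ⟨0, hx⟩, ?_⟩
      rintro (hx | ⟨-, hx⟩)
      · exact hx.elim
      · exact hx

theorem HasLoopTreeTop.attach {N U : Type*} {F : N} {R : Rooted N U} {n : ℕ}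
    {L : Fin n → Rooted N U} (hR : R.IsSingleton ∨ R.IsCycle) (hF : R.concept F = ∅)
    (hL : ∀ i, HasLoopTreeTop F (L i)) (hdisj : ∀ i j, i ≠ j → Disjoint (L i).dom (L j).dom)
    (hdisjR : ∀ i, Disjoint R.dom (L i).dom) : HasLoopTreeTop F (R.attach L) := by
  choose T m M hT hM hMdisj hTM hcrit hLeq using hL
  obtain rfl : L = fun i => (T i).union (M i) := funext hLeq
  have hsubT : ∀ i, (T i).dom ⊆ ((T i).union (M i)).dom := fun i => Set.subset_union_left
  have hsubM : ∀ i j, (M i j).dom ⊆ ((T i).union (M i)).dom := fun i j x hx =>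
    Rooted.mem_union_dom.2 (Or.inr ⟨j, hx⟩)
  let e : Fin (∑ i, m i) ≃ Σ i, Fin (m i) := finSigmaFinEquiv.symm
  refine ⟨R.attach T, ∑ i, m i, fun k => M (e k).1 (e k).2, ?_, fun k => hM _ _, ?_, ?_, ?_, ?_⟩
  · refine .attach R n T hR hF hT (fun i j hij => ?_) (fun i => ?_)
    · intro x hx
      exact absurd (hsubT j hx.2) (Set.disjoint_left.1 (hdisj i j hij) (hsubT i hx.1))
    · intro x hx
      exact absurd (hsubT i hx.2) (Set.disjoint_left.1 (hdisjR i) hx.1)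
  · intro k l hkl
    have hne : e k ≠ e l := fun h => hkl (e.injective h)
    dsimp only
    generalize e k = a at hne
    generalize e l = b at hne
    obtain ⟨i, j⟩ := a
    obtain ⟨i', j'⟩ := b
    by_cases hi : i = i'
    · subst hi
      exact hMdisj i j j' fun h => hne (by rw [h])
    · exact (hdisj i i' hi).mono (hsubM i j) (hsubM i' j')
  · intro k
    dsimp only
    generalize e k = a
    obtain ⟨i, j⟩ := a
    dsimp only
    rw [← hTM i j]
    ext x
    simp only [Set.mem_inter_iff, Rooted.mem_attach_dom]
    constructor
    · rintro ⟨hx | ⟨i', hx⟩, hx'⟩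
      · exact absurd (hsubM i j hx') (Set.disjoint_left.1 (hdisjR i) hx)
      · by_cases hi : i = i'
        · subst hi
          exact ⟨hx, hx'⟩
        · exact absurd (hsubT i' hx) (Set.disjoint_left.1 (hdisj i i' hi) (hsubM i j hx'))
    · exact fun ⟨h1, h2⟩ => ⟨Or.inr ⟨i, h1⟩, h2⟩
  · intro k
    exact ⟨Rooted.mem_attach_concept.2 (Or.inr ⟨_, (hcrit _ _).1⟩), (hcrit _ _).2⟩
  · have hex : ∀ p : (Σ i, Fin (m i)) → Prop, (∃ k, p (e k)) ↔ ∃ i j, p ⟨i, j⟩ := by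
      intro p
      rw [e.exists_congr_left]
      simp
    refine Rooted.eq_of_fields (fun x => ?_) (fun A x => ?_) (fun x y => ?_) rfl
    · rw [Rooted.mem_union_dom, Rooted.mem_attach_dom, Rooted.mem_attach_dom,
        hex fun a => x ∈ (M a.1 a.2).dom]
      simp only [Rooted.mem_union_dom, exists_or, or_assoc]
    · rw [Rooted.mem_union_concept, Rooted.mem_attach_concept, Rooted.mem_attach_concept,
        hex fun a => x ∈ (M a.1 a.2).concept A]
      simp only [Rooted.mem_union_concept, exists_or, or_assoc]
    · rw [Rooted.union_role, Rooted.attach_role, Rooted.attach_role,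
        hex fun a => (M a.1 a.2).role x y]
      simp only [Rooted.union_role, exists_or]
      have : ∀ i, ((T i).union (M i)).root = (T i).root := fun _ => rfl
      simp only [this]
      generalize (∃ i j, (M i j).role x y) = p
      generalize (∃ i, (T i).role x y) = q
      tauto

/-- The attached interpretations hang below a noncritical copy of the critical root, which the
cluster is then glued to. -/
theorem IsElementary.attach_critCluster {N U : Type*} {F : N} {R : Rooted N U} {n : ℕ}
    {L : Fin n → Rooted N U} (hR : R.IsWholeCritCluster F)
    (hL : ∀ i, HasLoopTreeTop F (L i)) (hdisj : ∀ i j, i ≠ j → Disjoint (L i).dom (L j).dom)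
    (hdisjR : ∀ i, Disjoint R.dom (L i).dom) : IsElementary F (R.attach L) := by
  have hnot : ∀ i, R.root ∉ (L i).dom := fun i => Set.disjoint_left.1 (hdisjR i) R.root_mem
  have hJ : HasLoopTreeTop F ((Rooted.point R.root (∅ : Set N)).attach L) := by
    refine HasLoopTreeTop.attach (Or.inl (Rooted.isSingleton_point _ _)) ?_ hL hdisj fun i => ?_
    · ext x
      simp [Rooted.point]
    · exact Set.disjoint_singleton_left.2 (hnot i)
  have heq : R.attach L =
      R.union fun _ : Unit => (Rooted.point R.root (∅ : Set N)).attach L := by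
    refine Rooted.eq_of_fields (fun x => ?_) (fun A x => ?_) (fun x y => ?_) rfl
    · rw [Rooted.mem_union_dom, Rooted.mem_attach_dom, Rooted.mem_attach_dom]
      constructor
      · rintro (h | h)
        · exact Or.inl h
        · exact Or.inr ⟨(), Or.inr h⟩
      · rintro (h | ⟨-, h | h⟩)
        · exact Or.inl h
        · exact Or.inl ((show x = R.root from h) ▸ R.root_mem)
        · exact Or.inr h
    · rw [Rooted.mem_union_concept, Rooted.mem_attach_concept, Rooted.mem_attach_concept]
      constructor
      · rintro (h | h)
        · exact Or.inl h
        · exact Or.inr ⟨(), Or.inr h⟩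
      · rintro (h | ⟨-, h | h⟩)
        · exact Or.inl h
        · exact absurd h.2 (Set.notMem_empty A)
        · exact Or.inr h
    · rw [Rooted.union_role, Rooted.attach_role, Rooted.attach_role]
      constructor
      · rintro ((h | h) | h)
        · exact Or.inl h
        · exact Or.inr ⟨(), Or.inl (Or.inr h)⟩
        · exact Or.inr ⟨(), Or.inr h⟩
      · rintro (h | ⟨-, (h | h) | h⟩)
        · exact Or.inl (Or.inl h)
        · exact h.elim
        · exact Or.inl (Or.inr h)
        · exact Or.inr h
  rw [heq]
  refine .critClusterUnion R _ hR hJ.isElementary ?_ ?_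
  · intro h
    obtain ⟨z, -, hz⟩ := Relation.TransGen.tail'_iff.1 h
    rcases Rooted.attach_role.1 hz with (h | ⟨i, h⟩) | ⟨-, i, h⟩
    · exact h
    · exact hnot i ((L i).role_sub _ _ h).2
    · exact hnot i ((show R.root = (L i).root from h) ▸ (L i).root_mem)
  · ext x
    rw [Set.mem_inter_iff, Rooted.mem_attach_dom]
    constructor
    · rintro ⟨h1, h2 | ⟨i, h2⟩⟩
      · exact h2
      · exact absurd h2 (Set.disjoint_left.1 (hdisjR i) h1)
    · intro h
      exact ⟨(show x = R.root from h) ▸ R.root_mem, Or.inl h⟩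

/-- The blocks from which the tree-shaped patterns are built: noncritical singletons and cycles,
and critical clusters with a critical root. -/
def IsBlock {N U : Type*} (F : N) (R : Rooted N U) : Prop :=
  ((R.IsSingleton ∨ R.IsCycle) ∧ R.concept F = ∅) ∨
    (R.IsWholeCritCluster F ∧ R.root ∈ R.concept F)

theorem IsBlock.hasLoopTreeTop_attach {N U : Type*} {F : N} {R : Rooted N U} {n : ℕ}
    {L : Fin n → Rooted N U} (hR : IsBlock F R)
    (hL : ∀ i, HasLoopTreeTop F (L i)) (hdisj : ∀ i j, i ≠ j → Disjoint (L i).dom (L j).dom)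
    (hdisjR : ∀ i, Disjoint R.dom (L i).dom) : HasLoopTreeTop F (R.attach L) := by
  rcases hR with ⟨h1, h2⟩ | ⟨h1, h2⟩
  · exact HasLoopTreeTop.attach h1 h2 hL hdisj hdisjR
  · exact (IsElementary.attach_critCluster h1 hL hdisj hdisjR).hasLoopTreeTop
      (Rooted.mem_attach_concept.2 (Or.inl h2))

/-! ### Reachability after attaching -/

theorem Rooted.transGen_attach_iff {N U : Type*} {R : Rooted N U} {κ : Type}
    {L : κ → Rooted N U} (hdisj : ∀ i j, i ≠ j → Disjoint (L i).dom (L j).dom)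
    (hdisjR : ∀ i, Disjoint R.dom (L i).dom) {i : κ} {x y : U} (hx : x ∈ (L i).dom) :
    Relation.TransGen (R.attach L).role x y ↔ Relation.TransGen (L i).role x y := by
  have hstep : ∀ {x y}, x ∈ (L i).dom → (R.attach L).role x y → (L i).role x y := by
    intro x y hx h
    rcases Rooted.attach_role.1 h with (h | ⟨j, h⟩) | ⟨rfl, -⟩
    · exact absurd hx (Set.disjoint_left.1 (hdisjR i) (R.role_sub _ _ h).1)
    · by_cases hij : i = j
      · exact hij ▸ h
      · exact absurd ((L j).role_sub _ _ h).1 (Set.disjoint_left.1 (hdisj i j hij) hx)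
    · exact absurd hx (Set.disjoint_left.1 (hdisjR i) R.root_mem)
  constructor
  · intro h
    induction h with
    | single h => exact .single (hstep hx h)
    | tail _ h ih =>
      obtain ⟨z, -, hz⟩ := Relation.TransGen.tail'_iff.1 ih
      exact ih.tail (hstep ((L i).role_sub _ _ hz).2 h)
  · exact Relation.TransGen.mono (fun a b h => Or.inl (Or.inr ⟨i, h⟩)) x y

theorem Rooted.mem_concept_of_mem_attach {N U : Type*} {R : Rooted N U} {κ : Type}
    {L : κ → Rooted N U} (hdisj : ∀ i j, i ≠ j → Disjoint (L i).dom (L j).dom)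
    (hdisjR : ∀ i, Disjoint R.dom (L i).dom) {i : κ} {x : U} (hx : x ∈ (L i).dom) {A : N} :
    x ∈ (R.attach L).concept A ↔ x ∈ (L i).concept A := by
  rw [Rooted.mem_attach_concept]
  constructor
  · rintro (h | ⟨j, h⟩)
    · exact absurd hx (Set.disjoint_left.1 (hdisjR i) (R.concept_sub A h))
    · by_cases hij : i = j
      · exact hij ▸ h
      · exact absurd ((L j).concept_sub A h) (Set.disjoint_left.1 (hdisj i j hij) hx)
  · exact fun h => Or.inr ⟨i, h⟩

theorem Rooted.rch_attach {N U : Type*} {R : Rooted N U} {κ : Type}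
    {L : κ → Rooted N U} (hdisj : ∀ i j, i ≠ j → Disjoint (L i).dom (L j).dom)
    (hdisjR : ∀ i, Disjoint R.dom (L i).dom) {i : κ} {x : U} (hx : x ∈ (L i).dom) :
    (R.attach L).rch x = (L i).rch x := by
  ext A
  constructor
  · rintro ⟨v, hv, h⟩
    rw [Rooted.transGen_attach_iff hdisj hdisjR hx] at h
    obtain ⟨z, -, hz⟩ := Relation.TransGen.tail'_iff.1 h
    exact ⟨v, (Rooted.mem_concept_of_mem_attach hdisj hdisjR ((L i).role_sub _ _ hz).2).1 hv, h⟩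
  · rintro ⟨v, hv, h⟩
    exact ⟨v, Rooted.mem_attach_concept.2 (Or.inr ⟨i, hv⟩),
      (Rooted.transGen_attach_iff hdisj hdisjR hx).2 h⟩

theorem Rooted.mem_critPart_of_attach {N U : Type*} {F : N} {R : Rooted N U} {κ : Type}
    {L : κ → Rooted N U} (hdisj : ∀ i j, i ≠ j → Disjoint (L i).dom (L j).dom)
    (hdisjR : ∀ i, Disjoint R.dom (L i).dom) {x : U} (hx : x ∈ (R.attach L).critPart F) :
    (x ∈ R.dom → (R.concept F).Nonempty) ∧ ∀ i, x ∈ (L i).dom → x ∈ (L i).critPart F := by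
  obtain ⟨f, hf, hxf, hfx⟩ := Interp.mem_critPart.1 hx
  have hreach : ∀ i {x y}, x ∈ (L i).dom → Relation.ReflTransGen (R.attach L).role x y →
      Relation.ReflTransGen (L i).role x y := by
    intro i x y hx h
    rw [Relation.reflTransGen_iff_eq_or_transGen] at h ⊢
    rwa [Rooted.transGen_attach_iff hdisj hdisjR hx] at h
  constructor
  · intro hxR
    rcases Rooted.mem_attach_concept.1 hf with hf | ⟨i, hf⟩
    · exact ⟨f, hf⟩
    · have := Interp.mem_dom_of_reflTransGen ((L i).concept_sub F hf)
        (hreach i ((L i).concept_sub F hf) hfx)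
      exact absurd this (Set.disjoint_left.1 (hdisjR i) hxR)
  · intro i hxi
    have h1 := hreach i hxi hxf
    have hfi := Interp.mem_dom_of_reflTransGen hxi h1
    exact Interp.mem_critPart.2 ⟨f, (Rooted.mem_concept_of_mem_attach hdisj hdisjR hfi).1 hf, h1,
      hreach i hfi hfx⟩

/-- Attaching realizable patterns to the root of a block. -/
theorem Pattern.IsRealizable.attach {N U X : Type*} {F : N} {I : Labelled N U X}
    {R : Rooted N U} {sim : U → U → Prop} {κ : Type} {L : κ → Pattern N U}
    (hL : ∀ i, (L i).IsRealizable F I)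
    (hdisj : ∀ i j, i ≠ j → Disjoint (L i).base.dom (L j).base.dom)
    (hdisjR : ∀ i, Disjoint R.dom (L i).base.dom)
    (mem : ∀ {e w}, sim e w → e ∈ R.dom ∧ w ∈ I.dom)
    (total : ∀ {e}, e ∈ R.dom → ∃ w, sim e w)
    (type_eq : ∀ {e w}, sim e w → R.type e = I.type w)
    (label_eq : ∀ {e w w'}, sim e w → sim e w' → I.label w = I.label w')
    (crit_eq : (R.concept F).Nonempty → ∀ {e w w'}, sim e w → sim e w' → w = w')
    (step : ∀ {e w e'}, sim e w → R.role e e' → ∃ w', I.role w w' ∧ sim e' w')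
    (enter : ∀ {w}, sim R.root w → ∀ i, ∃ w', I.role w w' ∧ (L i).sim (L i).base.root w')
    (rch : ∀ {e w}, sim e w → ∀ A ∈ I.rch w, A ∈ R.rch e ∨
      (Relation.ReflTransGen R.role e R.root ∧
        ∃ i, A ∈ (L i).base.type (L i).base.root ∨ A ∈ (L i).base.rch (L i).base.root)) :
    Pattern.IsRealizable F I
      ⟨R.attach fun i => (L i).base, fun e w => sim e w ∨ ∃ i, (L i).sim e w⟩ := by
  have hout : ∀ {e w i}, sim e w → ¬ e ∈ (L i).base.dom := fun h =>
    Set.disjoint_left.1 (hdisjR _) (mem h).1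
  have huniq : ∀ {e w i j}, (L i).sim e w → e ∈ (L j).base.dom → i = j := by
    intro e w i j h hj
    by_contra hij
    exact Set.disjoint_left.1 (hdisj i j hij) ((hL i).mem h).1 hj
  refine ⟨?_, ?_, ?_, ?_, ?_, ?_, ?_⟩
  · rintro e w (h | ⟨i, h⟩)
    · exact ⟨Rooted.mem_attach_dom.2 (Or.inl (mem h).1), (mem h).2⟩
    · exact ⟨Rooted.mem_attach_dom.2 (Or.inr ⟨i, ((hL i).mem h).1⟩), ((hL i).mem h).2⟩
  · intro e he
    rcases Rooted.mem_attach_dom.1 he with he | ⟨i, he⟩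
    · obtain ⟨w, hw⟩ := total he
      exact ⟨w, Or.inl hw⟩
    · obtain ⟨w, hw⟩ := (hL i).total he
      exact ⟨w, Or.inr ⟨i, hw⟩⟩
  · rintro e w (h | ⟨i, h⟩)
    · rw [← type_eq h]
      ext A
      refine Rooted.mem_attach_concept.trans ⟨?_, Or.inl⟩
      rintro (h1 | ⟨i, h1⟩)
      · exact h1
      · exact absurd ((L i).base.concept_sub A h1) (hout h)
    · rw [← (hL i).type_eq h]
      ext A
      exact Rooted.mem_concept_of_mem_attach hdisj hdisjR ((hL i).mem h).1
  · rintro e w w' (h | ⟨i, h⟩) (h' | ⟨j, h'⟩)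
    · exact label_eq h h'
    · exact absurd ((hL j).mem h').1 (hout h)
    · exact absurd ((hL i).mem h).1 (hout h')
    · obtain rfl := huniq h ((hL j).mem h').1
      exact (hL i).label_eq h h'
  · rintro e w (h | ⟨i, h⟩)
    · intro A hA
      have hmono : ∀ {x y}, Relation.TransGen R.role x y →
          Relation.TransGen (R.attach fun i => (L i).base).role x y :=
        fun {x y} => Relation.TransGen.mono (fun a b h => Or.inl (Or.inl h)) x y
      have hmonoL : ∀ {i x y}, Relation.TransGen (L i).base.role x y →
          Relation.TransGen (R.attach fun i => (L i).base).role x y :=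
        fun {i x y} => Relation.TransGen.mono (fun a b h => Or.inl (Or.inr ⟨i, h⟩)) x y
      rcases rch h A hA with ⟨v, hv, hev⟩ | ⟨h1, i, h2⟩
      · exact ⟨v, Rooted.mem_attach_concept.2 (Or.inl hv), hmono hev⟩
      · have h3 : Relation.TransGen (R.attach fun i => (L i).base).role e (L i).base.root := by
          refine Relation.TransGen.tail' (b := R.root) ?_ (Or.inr ⟨rfl, i, rfl⟩)
          exact Relation.ReflTransGen.mono (fun a b h => Or.inl (Or.inl h)) e R.root h1
        rcases h2 with h2 | ⟨v, hv, h2⟩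
        · exact ⟨_, Rooted.mem_attach_concept.2 (Or.inr ⟨i, h2⟩), h3⟩
        · exact ⟨v, Rooted.mem_attach_concept.2 (Or.inr ⟨i, hv⟩), h3.trans (hmonoL h2)⟩
    · refine ((hL i).rch_sub h).trans_eq ?_
      exact (Rooted.rch_attach hdisj hdisjR ((hL i).mem h).1).symm
  · intro e w w' he
    have he := Rooted.mem_critPart_of_attach hdisj hdisjR he
    rintro (h | ⟨i, h⟩) (h' | ⟨j, h'⟩)
    · exact crit_eq (he.1 (mem h).1) h h'
    · exact absurd ((hL j).mem h').1 (hout h)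
    · exact absurd ((hL i).mem h).1 (hout h')
    · obtain rfl := huniq h ((hL j).mem h').1
      exact (hL i).crit_eq (he.2 i ((hL i).mem h).1) h h'
  · rintro e w e' (h | ⟨i, h⟩) hr
    · rcases Rooted.attach_role.1 hr with (hr | ⟨i, hr⟩) | ⟨rfl, i, rfl⟩
      · obtain ⟨w', h1, h2⟩ := step h hr
        exact ⟨w', h1, Or.inl h2⟩
      · exact absurd ((L i).base.role_sub _ _ hr).1 (hout h)
      · obtain ⟨w', h1, h2⟩ := enter h i
        exact ⟨w', h1, Or.inr ⟨i, h2⟩⟩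
    · have hr' : (L i).base.role e e' := by
        rcases Rooted.attach_role.1 hr with (hr | ⟨j, hr⟩) | ⟨rfl, -⟩
        · exact absurd ((hL i).mem h).1 (Set.disjoint_left.1 (hdisjR i) (R.role_sub _ _ hr).1)
        · obtain rfl := huniq h ((L j).base.role_sub _ _ hr).1
          exact hr
        · exact absurd ((hL i).mem h).1 (Set.disjoint_left.1 (hdisjR i) R.root_mem)
      obtain ⟨w', h1, h2⟩ := (hL i).step h hr'
      exact ⟨w', h1, Or.inr ⟨i, h2⟩⟩

/-! ### Small patterns built from a block -/

/-- The interpretation with elements `c i`, where `c i` has the type `T i`, with edges from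
`c i` to `c j` whenever `r i j`, and with root `c i₀`. -/
def Rooted.ofFamily {N U : Type*} {ι : Type*} (c : ι → U) (T : ι → Set N) (r : ι → ι → Prop)
    (i₀ : ι) : Rooted N U where
  dom := Set.range c
  concept A := {x | ∃ i, c i = x ∧ A ∈ T i}
  role x y := ∃ i j, c i = x ∧ c j = y ∧ r i j
  concept_sub := fun _ _ ⟨i, hi, _⟩ => ⟨i, hi⟩
  role_sub := fun _ _ ⟨i, j, hi, hj, _⟩ => ⟨⟨i, hi⟩, ⟨j, hj⟩⟩
  root := c i₀
  root_mem := ⟨i₀, rfl⟩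

/-- A realizable pattern with at most `b` elements whose base has a loop tree at the top. -/
structure Pattern.IsSmall {N U X : Type*} (F : N) (I : Labelled N U X) (b : ℕ)
    (P : Pattern N U) : Prop where
  realizable : P.IsRealizable F I
  top : HasLoopTreeTop F P.base
  finite : P.base.dom.Finite
  card_le : P.base.dom.ncard ≤ b

theorem Pattern.IsSmall.mono {N U X : Type*} {F : N} {I : Labelled N U X} {b b' : ℕ}
    {P : Pattern N U} (h : P.IsSmall F I b) (hb : b ≤ b') : P.IsSmall F I b' :=
  ⟨h.realizable, h.top, h.finite, h.card_le.trans hb⟩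

/-- A block with elements `c i`, realized as prescribed by `s i`, and small patterns `M A`
for `A ∈ S` attached to its root yield a small pattern. -/
theorem exists_isSmall_attach {N U X : Type*} {F : N} {I : Labelled N U X} {b : ℕ} {ι : Type*}
    [Finite ι] {c : ι → U} (hc : Function.Injective c) {T : ι → Set N} {r : ι → ι → Prop} {i₀ : ι}
    (hblock : IsBlock F (Rooted.ofFamily c T r i₀)) (s : ι → U → Prop)
    {S : Set N} (hS : S.Finite) {M : N → Pattern N U} (hM : ∀ A ∈ S, (M A).IsSmall F I b)
    (hdisj : ∀ A ∈ S, ∀ B ∈ S, A ≠ B → Disjoint (M A).base.dom (M B).base.dom)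
    (hcM : ∀ A ∈ S, ∀ i, c i ∉ (M A).base.dom)
    (mem : ∀ {i w}, s i w → w ∈ I.dom) (total : ∀ i, ∃ w, s i w)
    (type_eq : ∀ {i w}, s i w → T i = I.type w)
    (label_eq : ∀ {i w w'}, s i w → s i w' → I.label w = I.label w')
    (crit_eq : ∀ j, F ∈ T j → ∀ {i w w'}, s i w → s i w' → w = w')
    (step : ∀ {i j w}, s i w → r i j → ∃ w', I.role w w' ∧ s j w')
    (enter : ∀ {w}, s i₀ w → ∀ A ∈ S, ∃ w', I.role w w' ∧ (M A).sim (M A).base.root w')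
    (rch : ∀ {i w}, s i w → ∀ A ∈ I.rch w, (∃ j, Relation.TransGen r i j ∧ A ∈ T j) ∨
      (Relation.ReflTransGen r i i₀ ∧ ∃ B ∈ S,
        A ∈ (M B).base.type (M B).base.root ∨ A ∈ (M B).base.rch (M B).base.root)) :
    ∃ P : Pattern N U, P.IsSmall F I (Nat.card ι + S.ncard * b) ∧ P.base.root = c i₀ ∧
      P.base.dom ⊆ Set.range c ∪ ⋃ A ∈ S, (M A).base.dom ∧
      (∀ w, s i₀ w → P.sim P.base.root w) ∧
      ((∀ i, ¬ r i i₀) → ∀ x, ¬ P.base.role x P.base.root) := by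
  classical
  have := hS.fintype
  let en : Fin (Fintype.card S) ≃ S := (Fintype.equivFin S).symm
  let L : Fin (Fintype.card S) → Pattern N U := fun k => M (en k)
  let R : Rooted N U := Rooted.ofFamily c T r i₀
  let sim : U → U → Prop := fun e w => ∃ i, c i = e ∧ s i w
  have hL : ∀ k, (L k).IsSmall F I b := fun k => hM _ (en k).2
  have hLdisj : ∀ k l, k ≠ l → Disjoint (L k).base.dom (L l).base.dom := fun k l hkl =>
    hdisj _ (en k).2 _ (en l).2 fun h => hkl (en.injective (Subtype.ext h))
  have hRdisj : ∀ k, Disjoint R.dom (L k).base.dom := by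
    intro k
    rw [Set.disjoint_left]
    rintro _ ⟨i, rfl⟩
    exact hcM _ (en k).2 i
  have hlift : ∀ {i j}, r i j → R.role (c i) (c j) := fun h => ⟨_, _, rfl, rfl, h⟩
  have hdom : (R.attach fun k => (L k).base).dom = R.dom ∪ ⋃ k, (L k).base.dom := rfl
  refine ⟨⟨R.attach fun k => (L k).base, fun e w => sim e w ∨ ∃ k, (L k).sim e w⟩,
    ⟨?_, ?_, ?_, ?_⟩, rfl, ?_, ?_, ?_⟩
  · refine Pattern.IsRealizable.attach (fun k => (hL k).realizable) hLdisj hRdisj ?_ ?_ ?_ ?_ ?_ ?_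
      ?_ ?_
    · rintro e w ⟨i, rfl, h⟩
      exact ⟨⟨i, rfl⟩, mem h⟩
    · rintro _ ⟨i, rfl⟩
      obtain ⟨w, hw⟩ := total i
      exact ⟨w, i, rfl, hw⟩
    · rintro e w ⟨i, rfl, h⟩
      rw [← type_eq h]
      ext A
      constructor
      · rintro ⟨j, hj, hA⟩
        exact hc hj ▸ hA
      · exact fun hA => ⟨i, rfl, hA⟩
    · rintro e w w' ⟨i, rfl, h⟩ ⟨j, hj, h'⟩
      obtain rfl := hc hj
      exact label_eq h h'
    · rintro ⟨_, k, rfl, hk⟩ e w w' ⟨i, rfl, h⟩ ⟨j, hj, h'⟩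
      obtain rfl := hc hj
      exact crit_eq k hk h h'
    · rintro e w e' ⟨i, rfl, h⟩ ⟨i', j, hi, rfl, hij⟩
      obtain rfl := hc hi
      obtain ⟨w', h1, h2⟩ := step h hij
      exact ⟨w', h1, j, rfl, h2⟩
    · rintro w ⟨i, hi, h⟩ k
      obtain rfl := hc hi
      exact enter h _ (en k).2
    · rintro e w ⟨i, rfl, h⟩ A hA
      rcases rch h A hA with ⟨j, h1, h2⟩ | ⟨h1, B, hB, h2⟩
      · exact Or.inl ⟨c j, ⟨j, rfl, h2⟩, Relation.TransGen.lift c (fun _ _ => hlift) _ _ h1⟩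
      · refine Or.inr ⟨Relation.ReflTransGen.lift c (fun _ _ => hlift) _ _ h1, en.symm ⟨B, hB⟩, ?_⟩
        simpa [L] using h2
  · exact hblock.hasLoopTreeTop_attach (fun k => (hL k).top) hLdisj hRdisj
  · dsimp only
    rw [hdom]
    exact (Set.finite_range c).union (Set.finite_iUnion fun k => (hL k).finite)
  · dsimp only
    rw [hdom]
    refine (Set.ncard_union_le _ _).trans (Nat.add_le_add ?_ ?_)
    · change (Set.range c).ncard ≤ _
      rw [← Set.image_univ, Set.ncard_image_of_injective _ hc, Set.ncard_univ]
    · refine (Set.ncard_iUnion_le_of_fintype _).trans ?_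
      refine (Finset.sum_le_card_nsmul _ _ b fun k _ => (hL k).card_le).trans ?_
      rw [Finset.card_univ, Fintype.card_fin, smul_eq_mul, ← Nat.card_coe_set_eq,
        Nat.card_eq_fintype_card]
  · dsimp only
    rw [hdom]
    refine Set.union_subset_union subset_rfl (Set.iUnion_subset fun k => ?_)
    exact Set.subset_biUnion_of_mem (u := fun A => (M A).base.dom) (en k).2
  · exact fun w hw => Or.inl ⟨i₀, rfl, hw⟩
  · intro hr x hx
    rcases Rooted.attach_role.1 hx with (⟨i, j, -, hj, hij⟩ | ⟨k, h⟩) | ⟨-, k, h⟩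
    · obtain rfl := hc hj
      exact hr i hij
    · exact hcM _ (en k).2 i₀ ((L k).base.role_sub _ _ h).2
    · have h' : c i₀ = (L k).base.root := h
      exact hcM _ (en k).2 i₀ (h' ▸ (L k).base.root_mem)

/-- If the witness for `w₀` can be chosen to serve all `w` with the same key, and there are only
finitely many keys, then finitely many witnesses suffice. -/
theorem exists_finite_cover {U κ α : Type*} {D : Set U} {key : U → κ} (hkey : (key '' D).Finite)
    {Q : α → Prop} {R : α → U → Prop}
    (h : ∀ w₀ ∈ D, ∃ M, Q M ∧ ∀ w ∈ D, key w = key w₀ → R M w) :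
    ∃ 𝓜 : Set α, 𝓜.Finite ∧ (∀ M ∈ 𝓜, Q M) ∧ ∀ w ∈ D, ∃ M ∈ 𝓜, R M w := by
  have h' : ∀ k : key '' D, ∃ M, Q M ∧ ∀ w ∈ D, key w = k → R M w := by
    rintro ⟨_, w₀, hw₀, rfl⟩
    exact h w₀ hw₀
  choose M hQ hR using h'
  have := hkey.to_subtype
  refine ⟨Set.range M, Set.finite_range M, ?_, fun w hw => ?_⟩
  · rintro _ ⟨k, rfl⟩
    exact hQ k
  · exact ⟨_, ⟨⟨key w, w, hw, rfl⟩, rfl⟩, hR _ w hw rfl⟩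

/-! ### Covering an interpretation by finitely many small patterns -/

/-- For every supply `W` of names and every name `r` outside of it, finitely many patterns with at
most `b` elements, with root `r` and with all the other elements in `W`, have roots that are
together realized by all the elements from which fewer than `t` concept names are reachable. -/
def HasCover {N U X : Type*} (F : N) (I : Labelled N U X) (t b : ℕ) : Prop :=
  ∀ W : Set U, W.Infinite → ∀ r ∉ W, ∃ 𝓜 : Set (Pattern N U), 𝓜.Finite ∧
    (∀ M ∈ 𝓜, M.IsSmall F I b ∧ M.base.root = r ∧ M.base.dom ⊆ insert r W ∧
      ∀ x, ¬ M.base.role x M.base.root) ∧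
    ∀ w ∈ I.dom, (I.rch w).ncard < t → ∃ M ∈ 𝓜, M.sim M.base.root w

/-- Covers `𝓜 A`, one for every concept name `A`, and further names `nm A`, all of them with
different elements of `W`. -/
structure IsCoverFamily {N U X : Type*} (F : N) (I : Labelled N U X) (t b : ℕ) (W : Set U)
    (𝓜 : N → Set (Pattern N U)) (nm : N → U) : Prop where
  finite : ∀ A ∈ I.occurring, (𝓜 A).Finite
  small : ∀ A ∈ I.occurring, ∀ M ∈ 𝓜 A, M.IsSmall F I b
  sub : ∀ A ∈ I.occurring, ∀ M ∈ 𝓜 A, M.base.dom ⊆ W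
  disj : ∀ A ∈ I.occurring, ∀ B ∈ I.occurring, A ≠ B → ∀ M ∈ 𝓜 A, ∀ M' ∈ 𝓜 B,
    Disjoint M.base.dom M'.base.dom
  cover : ∀ A ∈ I.occurring, ∀ w ∈ I.dom, (I.rch w).ncard < t →
    ∃ M ∈ 𝓜 A, M.sim M.base.root w
  nm_inj : Set.InjOn nm I.occurring
  nm_mem : ∀ A ∈ I.occurring, nm A ∈ W
  nm_notMem : ∀ A ∈ I.occurring, ∀ B ∈ I.occurring, ∀ M ∈ 𝓜 B, nm A ∉ M.base.dom

theorem HasCover.exists_isCoverFamily {N U X : Type*} {F : N} {I : Labelled N U X} {t b : ℕ}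
    (h : HasCover F I t b) (hocc : I.occurring.Finite) {W : Set U} (hW : W.Infinite) :
    ∃ 𝓜 nm, IsCoverFamily F I t b W 𝓜 nm := by
  classical
  obtain ⟨idx, hidx⟩ : ∃ idx : N → ℕ, Set.InjOn idx I.occurring := by
    have := hocc.to_subtype
    obtain ⟨n, ⟨e⟩⟩ := Finite.exists_equiv_fin I.occurring
    refine ⟨fun A => if hA : A ∈ I.occurring then e ⟨A, hA⟩ else 0, fun A hA B hB hAB => ?_⟩
    simp only [dif_pos hA, dif_pos hB] at hAB
    exact congrArg Subtype.val (e.injective (Fin.ext hAB))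
  let f : ℕ × ℕ → U := fun p => hW.natEmbedding W (Nat.pairEquiv p)
  have hf : Function.Injective f := fun p q hpq =>
    Nat.pairEquiv.injective ((hW.natEmbedding W).injective (Subtype.ext hpq))
  have hfW : ∀ p, f p ∈ W := fun p => (hW.natEmbedding W (Nat.pairEquiv p)).2
  -- Row `0` of `f` supplies the names `nm A`, row `idx A + 1` the elements for `𝓜 A`.
  let V : N → Set U := fun A => Set.range fun k => f (idx A + 1, k + 1)
  have hV : ∀ A, (V A).Infinite := fun A => Set.infinite_range_of_injective fun k l hkl => by
    simpa using hf hkl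
  have hr : ∀ A, f (idx A + 1, 0) ∉ V A := by
    rintro A ⟨k, hk⟩
    simpa using hf hk
  choose 𝓜 hfin hM hcov using fun A => h (V A) (hV A) _ (hr A)
  have hrow : ∀ A, ∀ M ∈ 𝓜 A, ∀ x ∈ M.base.dom, ∃ k, x = f (idx A + 1, k) := by
    intro A M hMA x hx
    rcases (hM A M hMA).2.2.1 hx with rfl | ⟨k, rfl⟩
    · exact ⟨0, rfl⟩
    · exact ⟨k + 1, rfl⟩
  refine ⟨𝓜, fun A => f (0, idx A), fun A _ => hfin A, fun A _ M hMA => (hM A M hMA).1, ?_, ?_,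
    fun A _ => hcov A, ?_, fun A _ => hfW _, ?_⟩
  · intro A _ M hMA x hx
    obtain ⟨k, rfl⟩ := hrow A M hMA x hx
    exact hfW _
  · intro A hA B hB hAB M hMA M' hMB
    rw [Set.disjoint_left]
    intro x hx hx'
    obtain ⟨k, rfl⟩ := hrow A M hMA x hx
    obtain ⟨l, hl⟩ := hrow B M' hMB _ hx'
    have := hf hl
    simp only [Prod.mk.injEq, add_left_inj] at this
    exact hAB (hidx hA hB this.1)
  · intro A hA B hB hAB
    have := hf hAB
    simp only [Prod.mk.injEq, true_and] at this
    exact hidx hA hB this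
  · intro A _ B _ M hMB hx
    obtain ⟨k, hk⟩ := hrow B M hMB _ hx
    simpa using hf hk

/-- The pairs of a concept name `A` and a pattern from `𝓜 A` that has `A` at its root and is
realized at a successor of `u`. -/
def available {N U X : Type*} (I : Labelled N U X) (𝓜 : N → Set (Pattern N U)) (u : U) :
    Set (N × Pattern N U) :=
  {p | p.1 ∈ I.occurring ∧ p.2 ∈ 𝓜 p.1 ∧ p.1 ∈ p.2.base.type p.2.base.root ∧
    ∃ w, I.role u w ∧ p.2.sim p.2.base.root w}

theorem IsCoverFamily.exists_available {N U X : Type*} {F : N} {I : Labelled N U X} {t b : ℕ}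
    {W : Set U} {𝓜 : N → Set (Pattern N U)} {nm : N → U} (h : IsCoverFamily F I t b W 𝓜 nm)
    {u v : U} {A : N} (huv : I.role u v) (hA : v ∈ I.concept A) (hv : (I.rch v).ncard < t) :
    ∃ M, (A, M) ∈ available I 𝓜 u := by
  obtain ⟨M, hM, hsim⟩ := h.cover A ⟨v, hA⟩ v (I.concept_sub A hA) hv
  refine ⟨M, ⟨v, hA⟩, hM, ?_, v, huv, hsim⟩
  rw [(h.small A ⟨v, hA⟩ M hM).realizable.type_eq hsim]
  exact hA

theorem IsCoverFamily.exists_finite_available {N U X : Type*} {F : N} {I : Labelled N U X}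
    {t b : ℕ} {W : Set U} {𝓜 : N → Set (Pattern N U)} {nm : N → U}
    (h : IsCoverFamily F I t b W 𝓜 nm) (hocc : I.occurring.Finite) :
    ∃ 𝓟 : Set (N × Pattern N U), 𝓟.Finite ∧ ∀ u, available I 𝓜 u ⊆ 𝓟 :=
  ⟨⋃ A ∈ I.occurring, Prod.mk A '' 𝓜 A, hocc.biUnion fun A hA => (h.finite A hA).image _,
    fun _ p hp => Set.mem_biUnion hp.1 ⟨p.2, hp.2.1, rfl⟩⟩

/-- If all witnesses for `A` among the successors of `v` have fewer reachable concept names than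
`v`, then the cover supplies a pattern for `A` at `v`. -/
theorem IsCoverFamily.exists_available_of_mem_rch {N U X : Type*} {F : N} {I : Labelled N U X}
    {t b : ℕ} {W : Set U} {𝓜 : N → Set (Pattern N U)} {nm : N → U}
    (h : IsCoverFamily F I t b W 𝓜 nm) (htrans : I.IsTransitive) (hocc : I.occurring.Finite)
    {v : U} {A : N} (hv : (I.rch v).ncard < t + 1) (hA : A ∈ I.rch v)
    (hne : ∀ x, I.role v x → x ∈ I.concept A → I.rch x ≠ I.rch v) :
    ∃ M, (A, M) ∈ available I 𝓜 v := by
  obtain ⟨x, hxA, hvx⟩ := htrans.mem_rch.1 hA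
  refine h.exists_available hvx hxA ?_
  have := Set.ncard_lt_ncard ((htrans.rch_subset hvx).ssubset_of_ne (hne x hvx hxA))
    (hocc.subset (Interp.rch_subset_occurring v))
  omega

/-- The pattern of a critical cluster: witnesses inside the cluster form a critical cluster, and
patterns with fewer reachable concept names are attached for the remaining concept names. -/
theorem IsCoverFamily.exists_isSmall_of_critical {N U X : Type*} {F : N} {I : Labelled N U X}
    {t b : ℕ} {W : Set U} {𝓜 : N → Set (Pattern N U)} {nm : N → U}
    (h : IsCoverFamily F I t b W 𝓜 nm) (htrans : I.IsTransitive) (hocc : I.occurring.Finite)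
    {c : U} (hcF : c ∈ I.concept F) (hcc : I.role c c)
    (hfinal : ∀ v, I.role c v → I.rch v = I.rch c → I.role v c)
    (hc : (I.rch c).ncard < t + 1) :
    ∃ P : Pattern N U,
      (P.IsSmall F I (I.occurring.ncard + I.occurring.ncard * b) ∧ P.base.dom ⊆ W) ∧
        P.sim P.base.root c := by
  classical
  let S₁ : Set N := {A | ∃ x ∈ I.concept A, I.role c x ∧ I.role x c}
  have hS₁ : S₁ ⊆ I.occurring := fun A ⟨x, hx, _⟩ => ⟨x, hx⟩
  have hFS₁ : F ∈ S₁ := ⟨c, hcF, hcc, hcc⟩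
  have hwit : ∀ A : S₁, ∃ x, x ∈ I.concept A ∧ I.role c x ∧ I.role x c ∧ (A.1 = F → x = c) := by
    rintro ⟨A, x, hx, h1, h2⟩
    by_cases hA : A = F
    · exact ⟨c, hA ▸ hcF, hcc, hcc, fun _ => rfl⟩
    · exact ⟨x, hx, h1, h2, fun h => absurd h hA⟩
  choose wit hwA hcw hwc hwF using hwit
  have hM : ∀ A, ∃ M, A ∈ I.rch c \ S₁ → (A, M) ∈ available I 𝓜 c := by
    intro A
    by_cases hA : A ∈ I.rch c \ S₁
    · obtain ⟨M, hM⟩ := h.exists_available_of_mem_rch htrans hocc hc hA.1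
        fun x hcx hxA hx => hA.2 ⟨x, hxA, hcx, hfinal x hcx hx⟩
      exact ⟨M, fun _ => hM⟩
    · exact ⟨⟨Rooted.point c ∅, fun _ _ => False⟩, fun h => absurd h hA⟩
  choose M hM using hM
  have := (hocc.subset hS₁).to_subtype
  have hinj : Function.Injective fun A : S₁ => nm A := fun A B hAB =>
    Subtype.ext (h.nm_inj (hS₁ A.2) (hS₁ B.2) hAB)
  have hSocc : I.rch c \ S₁ ⊆ I.occurring := Set.sdiff_subset.trans (Interp.rch_subset_occurring c)
  have hreach : ∀ A B : S₁, I.role (wit A) (wit B) := fun A B => htrans _ _ _ (hwc A) (hcw B)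
  obtain ⟨P, hP, -, hPdom, hPsim, -⟩ := exists_isSmall_attach (F := F) (I := I) (b := b) hinj
    (T := fun A => I.type (wit A)) (r := fun _ _ => True) (i₀ := ⟨F, hFS₁⟩)
    (Or.inr ⟨⟨by
      rintro _ ⟨A, rfl⟩ _ ⟨B, rfl⟩
      exact .single ⟨A, B, rfl, rfl, trivial⟩, ⟨_, ⟨F, hFS₁⟩, rfl, hwA ⟨F, hFS₁⟩⟩⟩,
      ⟨F, hFS₁⟩, rfl, hwA ⟨F, hFS₁⟩⟩)
    (fun A w => w = wit A) (hocc.subset hSocc) (M := M)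
    (fun A hA => h.small A (hSocc hA) _ (hM A hA).2.1)
    (fun A hA B hB hAB => h.disj A (hSocc hA) B (hSocc hB) hAB _ (hM A hA).2.1 _ (hM B hB).2.1)
    (fun A hA B => h.nm_notMem B (hS₁ B.2) A (hSocc hA) _ (hM A hA).2.1)
    (fun {A w} hw => hw ▸ I.concept_sub _ (hwA A)) (fun A => ⟨_, rfl⟩)
    (fun hw => by rw [hw]) (fun hw hw' => by rw [hw, hw'])
    (fun _ _ _ _ _ hw hw' => hw.trans hw'.symm)
    (fun {A B w} hw _ => ⟨_, hw ▸ hreach A B, rfl⟩)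
    (fun {w} hw A hA => by
      rw [hw, hwF ⟨F, hFS₁⟩ rfl]
      exact (hM A hA).2.2.2)
    (fun {B w} hw A hA => by
      subst hw
      by_cases hA₁ : A ∈ S₁
      · exact Or.inl ⟨⟨A, hA₁⟩, .single trivial, hwA ⟨A, hA₁⟩⟩
      · have hAc : A ∈ I.rch c \ S₁ := ⟨htrans.rch_subset (hcw B) hA, hA₁⟩
        exact Or.inr ⟨.single trivial, A, hAc, Or.inl (hM A hAc).2.2.1⟩)
  refine ⟨P, ⟨hP.mono (Nat.add_le_add ?_ (Nat.mul_le_mul_right _ ?_)), hPdom.trans ?_⟩,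
    hPsim c (hwF ⟨F, hFS₁⟩ rfl).symm⟩
  · rw [Nat.card_coe_set_eq]
    exact Set.ncard_le_ncard hS₁ hocc
  · exact Set.ncard_le_ncard hSocc hocc
  · refine Set.union_subset ?_ (Set.iUnion₂_subset fun A hA => h.sub A (hSocc hA) _ (hM A hA).2.1)
    rintro _ ⟨A, rfl⟩
    exact h.nm_mem A (hS₁ A.2)

theorem Rooted.isCycle_ofFamily {N U : Type*} {n : ℕ} {c : Fin (n + 1) → U}
    (hc : Function.Injective c) (T : Fin (n + 1) → Set N) (i₀ : Fin (n + 1)) :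
    (Rooted.ofFamily c T (fun i j => j = i + 1) i₀).IsCycle := by
  refine ⟨n, c, hc, rfl, fun x y => ⟨?_, ?_⟩⟩
  · rintro ⟨i, _, rfl, rfl, rfl⟩
    exact ⟨i, rfl, rfl⟩
  · rintro ⟨i, rfl, rfl⟩
    exact ⟨i, _, rfl, rfl, rfl⟩

theorem transGen_add_one {n : ℕ} (i j : Fin (n + 1)) :
    Relation.TransGen (fun i j : Fin (n + 1) => j = i + 1) i j := by
  have h₁ : ∀ j : Fin (n + 1), Relation.ReflTransGen (fun i j : Fin (n + 1) => j = i + 1) 0 j := by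
    intro j
    induction j using Fin.induction with
    | zero => exact .refl
    | succ j ih => exact ih.tail (Fin.coeSucc_eq_succ).symm
  have h₂ : ∀ i : Fin (n + 1),
      Relation.ReflTransGen (fun i j : Fin (n + 1) => j = i + 1) i (Fin.last n) := by
    intro i
    induction i using Fin.reverseInduction with
    | last => exact .refl
    | cast i ih => exact ih.head (Fin.coeSucc_eq_succ).symm
  exact (Relation.TransGen.tail' (h₂ i) (Fin.last_add_one n).symm).trans_left (h₁ j)

/-! ### Colours and recurrent colours -/

/-- The type of `v`, its label, and the patterns available at its successors. -/
def colour {N U X : Type*} (I : Labelled N U X) (𝓜 : N → Set (Pattern N U)) (v : U) :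
    Set N × X × Set (N × Pattern N U) :=
  (I.type v, I.label v, available I 𝓜 v)

/-- The colours of the successors of `v` from which the same concept names are reachable as
from `v`. -/
def future {N U X : Type*} (I : Labelled N U X) (𝓜 : N → Set (Pattern N U)) (v : U) :
    Set (Set N × X × Set (N × Pattern N U)) :=
  {k | ∃ v', I.role v v' ∧ I.rch v' = I.rch v ∧ colour I 𝓜 v' = k}

/-- No colour that is still ahead of `v` gets lost as long as the reachable concept names stay
the same. -/
def IsStable {N U X : Type*} (I : Labelled N U X) (𝓜 : N → Set (Pattern N U)) (v : U) : Prop :=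
  ∀ v', I.role v v' → I.rch v' = I.rch v → future I 𝓜 v' = future I 𝓜 v

theorem IsStable.of_role {N U X : Type*} {I : Labelled N U X} {𝓜 : N → Set (Pattern N U)}
    (htrans : I.IsTransitive) {v v' : U} (h : IsStable I 𝓜 v) (hr : I.role v v')
    (hrch : I.rch v' = I.rch v) : IsStable I 𝓜 v' := fun v'' h1 h2 =>
  (h v'' (htrans _ _ _ hr h1) (h2.trans hrch)).trans (h v' hr hrch).symm

theorem future_subset {N U X : Type*} {I : Labelled N U X} {𝓜 : N → Set (Pattern N U)}
    (htrans : I.IsTransitive) {v v' : U} (hr : I.role v v') (hrch : I.rch v' = I.rch v) :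
    future I 𝓜 v' ⊆ future I 𝓜 v := fun _ ⟨w, h1, h2, h3⟩ =>
  ⟨w, htrans _ _ _ hr h1, h2.trans hrch, h3⟩

theorem IsCoverFamily.exists_finite_colour {N U X : Type*} {F : N} {I : Labelled N U X}
    {t b : ℕ} {W : Set U} {𝓜 : N → Set (Pattern N U)} {nm : N → U}
    (h : IsCoverFamily F I t b W 𝓜 nm) (hocc : I.occurring.Finite)
    (hlabel : (I.label '' I.dom).Finite) :
    ∃ 𝓒 : Set (Set N × X × Set (N × Pattern N U)), 𝓒.Finite ∧
      ∀ v ∈ I.dom, colour I 𝓜 v ∈ 𝓒 := by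
  obtain ⟨𝓟, hfin, h𝓟⟩ := h.exists_finite_available hocc
  exact ⟨_, hocc.finite_subsets.prod (hlabel.prod hfin.finite_subsets), fun v hv =>
    ⟨Interp.type_subset_occurring v, ⟨v, hv, rfl⟩, h𝓟 v⟩⟩

theorem future_subset_of_colour_mem {N U X : Type*} {I : Labelled N U X}
    {𝓜 : N → Set (Pattern N U)} {𝓒 : Set (Set N × X × Set (N × Pattern N U))}
    (h𝓒 : ∀ v ∈ I.dom, colour I 𝓜 v ∈ 𝓒) (v : U) : future I 𝓜 v ⊆ 𝓒 := by
  rintro _ ⟨w, h1, -, rfl⟩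
  exact h𝓒 w (I.role_sub _ _ h1).2

/-- An element with the fewest colours ahead, among `u` and its successors with the same reachable
concept names, is stable. -/
theorem exists_isStable {N U X : Type*} {I : Labelled N U X} {𝓜 : N → Set (Pattern N U)}
    (htrans : I.IsTransitive) {𝓒 : Set (Set N × X × Set (N × Pattern N U))} (hfin : 𝓒.Finite)
    (h𝓒 : ∀ v ∈ I.dom, colour I 𝓜 v ∈ 𝓒) (u : U) :
    ∃ v, (v = u ∨ I.role u v) ∧ I.rch v = I.rch u ∧ IsStable I 𝓜 v := by
  obtain ⟨v, ⟨h1, h2⟩, hmin⟩ := (measure fun v => (future I 𝓜 v).ncard).wf.has_min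
    {v | (v = u ∨ I.role u v) ∧ I.rch v = I.rch u} ⟨u, Or.inl rfl, rfl⟩
  refine ⟨v, h1, h2, fun v' hr hrch => ?_⟩
  refine Set.eq_of_subset_of_ncard_le (future_subset htrans hr hrch) ?_
    (hfin.subset (future_subset_of_colour_mem h𝓒 v))
  refine not_lt.1 (hmin v' ⟨Or.inr ?_, hrch.trans h2⟩)
  rcases h1 with rfl | h1
  · exact hr
  · exact htrans _ _ _ h1 hr

/-- A nonempty finite set in which every element has a successor contains a reflexive element of
a bottom cluster. -/
theorem exists_bottom {U : Type*} {r : U → U → Prop} (htrans : ∀ x y z, r x y → r y z → r x z)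
    {C : Set U} (hfin : C.Finite) (hne : C.Nonempty) (hC : ∀ c ∈ C, ∃ c' ∈ C, r c c') :
    ∃ c ∈ C, r c c ∧ ∀ c' ∈ C, r c c' → r c' c := by
  obtain ⟨c₁, hc₁, hmin⟩ := (measure fun c => {c' ∈ C | r c c'}.ncard).wf.has_min C hne
  have hdown : ∀ c ∈ C, r c₁ c → ∀ c' ∈ C, r c₁ c' → r c c' := by
    intro c hc h c' hc' h'
    have heq : {c' ∈ C | r c c'} = {c' ∈ C | r c₁ c'} :=
      Set.eq_of_subset_of_ncard_le (fun x hx => ⟨hx.1, htrans _ _ _ h hx.2⟩)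
        (not_lt.1 (hmin c hc)) (hfin.subset (Set.sep_subset _ _))
    exact (heq.symm ▸ (show c' ∈ {c' ∈ C | r c₁ c'} from ⟨hc', h'⟩) :
      c' ∈ {c' ∈ C | r c c'}).2
  obtain ⟨c, hc, h⟩ := hC c₁ hc₁
  exact ⟨c, hc, hdown c hc h c hc h, fun c' hc' h' =>
    hdown c' hc' (htrans _ _ _ h h') c hc h⟩

/-- The elements that can realize the root of a cycle: their colour recurs for ever, their type
is not empty, and no critical element is ahead. -/
def IsRecurrent {N U X : Type*} (F : N) (I : Labelled N U X) (𝓜 : N → Set (Pattern N U))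
    (v : U) : Prop :=
  v ∈ I.dom ∧ IsStable I 𝓜 v ∧ colour I 𝓜 v ∈ future I 𝓜 v ∧ (I.type v).Nonempty ∧
    ∀ k ∈ future I 𝓜 v, F ∉ k.1

/-- The pattern of a cycle: one element for every concept name `A` that recurs, with a
recurrent colour whose type contains `A`. The realizers of an element of the cycle are all the
stable elements with its colour, so that the cycle can be followed for ever. -/
theorem IsCoverFamily.exists_isSmall_of_isRecurrent {N U X : Type*} {F : N} {I : Labelled N U X}
    {t b : ℕ} {W : Set U} {𝓜 : N → Set (Pattern N U)} {nm : N → U}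
    (h : IsCoverFamily F I t b W 𝓜 nm) (htrans : I.IsTransitive) (hocc : I.occurring.Finite)
    {v₀ : U} (hv₀ : IsRecurrent F I 𝓜 v₀) (hlt : (I.rch v₀).ncard < t + 1) :
    ∃ P : Pattern N U,
      (P.IsSmall F I (I.occurring.ncard + I.occurring.ncard * b) ∧ P.base.dom ⊆ W) ∧
        ∀ v, IsRecurrent F I 𝓜 v → I.rch v = I.rch v₀ → future I 𝓜 v = future I 𝓜 v₀ →
          colour I 𝓜 v = colour I 𝓜 v₀ → P.sim P.base.root v := by
  classical
  obtain ⟨hdom, hstable, hcol, ⟨A₀, hA₀⟩, hF⟩ := hv₀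
  let S₁ : Set N := {A | ∃ k ∈ future I 𝓜 v₀, A ∈ k.1}
  have hS₁ : S₁ ⊆ I.occurring := by
    rintro A ⟨_, ⟨v, -, -, rfl⟩, hA⟩
    exact ⟨v, hA⟩
  have hk : ∀ A : S₁, ∃ k ∈ future I 𝓜 v₀, A.1 ∈ k.1 ∧ (A.1 = A₀ → k = colour I 𝓜 v₀) := by
    rintro ⟨A, k, hk, hA⟩
    by_cases hAA : A = A₀
    · exact ⟨_, hcol, hAA ▸ hA₀, fun _ => rfl⟩
    · exact ⟨k, hk, hA, fun h => absurd h hAA⟩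
  choose k hkfut hkA hk₀ using hk
  have := (hocc.subset hS₁).to_subtype
  obtain ⟨n, ⟨en⟩⟩ : ∃ n, Nonempty (S₁ ≃ Fin (n + 1)) := by
    obtain ⟨m, ⟨en⟩⟩ := Finite.exists_equiv_fin S₁
    cases m with
    | zero => exact (en ⟨A₀, _, hcol, hA₀⟩).elim0
    | succ n => exact ⟨n, ⟨en⟩⟩
  let A₁ : S₁ := ⟨A₀, _, hcol, hA₀⟩
  -- The concept names that do not recur are seen through elements with fewer reachable names.
  have hav : ∀ v, IsStable I 𝓜 v → I.rch v = I.rch v₀ → future I 𝓜 v = future I 𝓜 v₀ →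
      ∀ A ∈ I.rch v₀ \ S₁, ∃ M, (A, M) ∈ available I 𝓜 v := by
    intro v hv hrch hfut A hA
    refine h.exists_available_of_mem_rch htrans hocc (hrch ▸ hlt) (hrch.symm ▸ hA.1) ?_
    intro x hvx hxA hx
    refine hA.2 ⟨colour I 𝓜 x, ?_, hxA⟩
    rw [← hfut]
    exact ⟨x, hvx, hx, rfl⟩
  have hM : ∀ A, ∃ M, A ∈ I.rch v₀ \ S₁ → (A, M) ∈ available I 𝓜 v₀ := by
    intro A
    by_cases hA : A ∈ I.rch v₀ \ S₁
    · obtain ⟨M, hM⟩ := hav v₀ hstable rfl rfl A hA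
      exact ⟨M, fun _ => hM⟩
    · exact ⟨⟨Rooted.point v₀ ∅, fun _ _ => False⟩, fun h => absurd h hA⟩
  choose M hM using hM
  let s : Fin (n + 1) → U → Prop := fun i w => w ∈ I.dom ∧ IsStable I 𝓜 w ∧
    I.rch w = I.rch v₀ ∧ future I 𝓜 w = future I 𝓜 v₀ ∧ colour I 𝓜 w = k (en.symm i)
  have hnext : ∀ w, IsStable I 𝓜 w → I.rch w = I.rch v₀ → future I 𝓜 w = future I 𝓜 v₀ →
      ∀ i, ∃ w', I.role w w' ∧ s i w' := by
    intro w h1 h2 h3 i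
    have h4 := hkfut (en.symm i)
    rw [← h3] at h4
    obtain ⟨w', h5, h6, h7⟩ := h4
    exact ⟨w', h5, (I.role_sub _ _ h5).2, h1.of_role htrans h5 h6, h6.trans h2,
      (h1 w' h5 h6).trans h3, h7⟩
  have hinj : Function.Injective fun i => nm (en.symm i) := fun i j hij =>
    en.symm.injective (Subtype.ext (h.nm_inj (hS₁ (en.symm i).2) (hS₁ (en.symm j).2) hij))
  have hSocc : I.rch v₀ \ S₁ ⊆ I.occurring :=
    Set.sdiff_subset.trans (Interp.rch_subset_occurring v₀)
  obtain ⟨P, hP, -, hPdom, hPsim, -⟩ := exists_isSmall_attach (F := F) (I := I) (b := b) hinj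
    (T := fun i => (k (en.symm i)).1) (r := fun i j => j = i + 1) (i₀ := en A₁)
    (Or.inl ⟨Or.inr (Rooted.isCycle_ofFamily hinj _ _), by
      ext x
      simp only [Set.mem_empty_iff_false, iff_false]
      rintro ⟨i, -, hi⟩
      exact hF _ (hkfut _) hi⟩)
    s (hocc.subset hSocc) (M := M)
    (fun A hA => h.small A (hSocc hA) _ (hM A hA).2.1)
    (fun A hA B hB hAB => h.disj A (hSocc hA) B (hSocc hB) hAB _ (hM A hA).2.1 _ (hM B hB).2.1)
    (fun A hA i => h.nm_notMem _ (hS₁ (en.symm i).2) A (hSocc hA) _ (hM A hA).2.1)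
    (fun hw => hw.1)
    (fun i => (hnext v₀ hstable rfl rfl i).imp fun _ hw => hw.2)
    (fun hw => (congrArg Prod.fst hw.2.2.2.2).symm)
    (fun hw hw' => congrArg (fun k => k.2.1) (hw.2.2.2.2.trans hw'.2.2.2.2.symm))
    (fun j hj => absurd hj (hF _ (hkfut _)))
    (fun {i j w} hw _ => hnext w hw.2.1 hw.2.2.1 hw.2.2.2.1 j)
    (fun {w} hw A hA => by
      have hw' : available I 𝓜 w = available I 𝓜 v₀ := by
        have hcol : colour I 𝓜 w = colour I 𝓜 v₀ := by
          rw [hw.2.2.2.2, Equiv.symm_apply_apply]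
          exact hk₀ A₁ rfl
        exact congrArg (fun k => k.2.2) hcol
      exact (hw' ▸ hM A hA : (A, M A) ∈ available I 𝓜 w).2.2.2)
    (fun {i w} hw A hA => by
      rw [hw.2.2.1] at hA
      by_cases hA₁ : A ∈ S₁
      · refine Or.inl ⟨en ⟨A, hA₁⟩, transGen_add_one _ _, ?_⟩
        rw [Equiv.symm_apply_apply]
        exact hkA ⟨A, hA₁⟩
      · exact Or.inr ⟨(transGen_add_one _ _).to_reflTransGen, A, ⟨hA, hA₁⟩,
          Or.inl (hM A ⟨hA, hA₁⟩).2.2.1⟩)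
  refine ⟨P, ⟨hP.mono (Nat.add_le_add ?_ (Nat.mul_le_mul_right _ ?_)), hPdom.trans ?_⟩,
    fun v hv h1 h2 h3 => hPsim v ⟨hv.1, hv.2.1, h1, h2, ?_⟩⟩
  · rw [← Nat.card_congr en, Nat.card_coe_set_eq]
    exact Set.ncard_le_ncard hS₁ hocc
  · exact Set.ncard_le_ncard hSocc hocc
  · refine Set.union_subset ?_ (Set.iUnion₂_subset fun A hA => h.sub A (hSocc hA) _ (hM A hA).2.1)
    rintro _ ⟨i, rfl⟩
    exact h.nm_mem _ (hS₁ (en.symm i).2)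
  · rw [Equiv.symm_apply_apply, h3]
    exact (hk₀ A₁ rfl).symm

/-- From every element either all the reachable concept names are available, or a cycle or a
critical cluster can be entered without losing a reachable concept name. -/
theorem IsCoverFamily.exists_blocks {N U X : Type*} {F : N} {I : Labelled N U X}
    {t b : ℕ} {W : Set U} {𝓜 : N → Set (Pattern N U)} {nm : N → U}
    (h : IsCoverFamily F I t b W 𝓜 nm) (htrans : I.IsTransitive) (hocc : I.occurring.Finite)
    (hcrit : (I.concept F).Finite) (hlabel : (I.label '' I.dom).Finite) :
    ∃ 𝓑 : Set (Pattern N U), 𝓑.Finite ∧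
      (∀ P ∈ 𝓑, P.IsSmall F I (I.occurring.ncard + I.occurring.ncard * b) ∧ P.base.dom ⊆ W) ∧
      ∀ u, (I.rch u).ncard < t + 1 →
        (∀ A ∈ I.rch u, ∃ M, (A, M) ∈ available I 𝓜 u) ∨
        ∃ P ∈ 𝓑, ∃ v, I.role u v ∧ I.rch v = I.rch u ∧ P.sim P.base.root v := by
  obtain ⟨𝓒, h𝓒fin, h𝓒⟩ := h.exists_finite_colour hocc hlabel
  obtain ⟨𝓑₁, hfin₁, hsmall₁, hcov₁⟩ := exists_finite_cover
    (D := {c | c ∈ I.concept F ∧ I.role c c ∧ (∀ v, I.role c v → I.rch v = I.rch c → I.role v c) ∧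
      (I.rch c).ncard < t + 1}) (key := id)
    (R := fun (P : Pattern N U) c => P.sim P.base.root c)
    ((hcrit.subset fun c hc => hc.1).image _) (fun c hc => by
      obtain ⟨P, hP, hPc⟩ := h.exists_isSmall_of_critical htrans hocc hc.1 hc.2.1 hc.2.2.1 hc.2.2.2
      exact ⟨P, hP, fun w _ hw => (show w = c from hw) ▸ hPc⟩)
  obtain ⟨𝓑₂, hfin₂, hsmall₂, hcov₂⟩ := exists_finite_cover
    (D := {v | IsRecurrent F I 𝓜 v ∧ (I.rch v).ncard < t + 1})
    (key := fun v => (I.rch v, future I 𝓜 v, colour I 𝓜 v))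
    (R := fun (P : Pattern N U) v => P.sim P.base.root v)
    ((hocc.finite_subsets.prod (h𝓒fin.finite_subsets.prod h𝓒fin)).subset (by
      rintro _ ⟨v, hv, rfl⟩
      exact ⟨Interp.rch_subset_occurring v, future_subset_of_colour_mem h𝓒 v, h𝓒 v hv.1.1⟩))
    (fun v₀ hv₀ => by
      obtain ⟨P, hP, hPv⟩ := h.exists_isSmall_of_isRecurrent htrans hocc hv₀.1 hv₀.2
      refine ⟨P, hP, fun v hv hkey => ?_⟩
      simp only [Prod.mk.injEq] at hkey
      exact hPv v hv.1 hkey.1 hkey.2.1 hkey.2.2)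
  refine ⟨𝓑₁ ∪ 𝓑₂, hfin₁.union hfin₂, ?_, fun u hu => ?_⟩
  · rintro P (hP | hP)
    · exact hsmall₁ P hP
    · exact hsmall₂ P hP
  obtain ⟨v₀, huv₀, hrch₀, hstable⟩ := exists_isStable (𝓜 := 𝓜) htrans h𝓒fin h𝓒 u
  have hrole : ∀ {x}, I.role v₀ x → I.role u x := by
    intro x hx
    rcases huv₀ with rfl | huv₀
    · exact hx
    · exact htrans _ _ _ huv₀ hx
  by_cases hS : ∃ A, ∃ k ∈ future I 𝓜 v₀, A ∈ k.1
  swap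
  · -- No successor of `v₀` with a nonempty type reaches as many concept names as `v₀`.
    left
    intro A hA
    rw [← hrch₀] at hA hu
    obtain ⟨M, hM⟩ := h.exists_available_of_mem_rch htrans hocc hu hA fun x hvx hxA hx =>
      hS ⟨A, colour I 𝓜 x, ⟨x, hvx, hx, rfl⟩, hxA⟩
    obtain ⟨h1, h2, h3, w, h4, h5⟩ := hM
    exact ⟨M, h1, h2, h3, w, hrole h4, h5⟩
  right
  by_cases hF : ∃ k ∈ future I 𝓜 v₀, F ∈ k.1
  · let C : Set U := {c | c ∈ I.concept F ∧ I.role v₀ c ∧ I.rch c = I.rch v₀}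
    have hahead : ∀ v, future I 𝓜 v = future I 𝓜 v₀ → I.rch v = I.rch v₀ →
        (v = v₀ ∨ I.role v₀ v) → ∃ c ∈ C, I.role v c := by
      intro v hv hrch hv₀
      obtain ⟨k, hk, hFk⟩ := hF
      rw [← hv] at hk
      obtain ⟨c, h1, h2, rfl⟩ := hk
      refine ⟨c, ⟨hFk, ?_, h2.trans hrch⟩, h1⟩
      rcases hv₀ with rfl | hv₀
      · exact h1
      · exact htrans _ _ _ hv₀ h1
    obtain ⟨c₀, hc₀, -⟩ := hahead v₀ rfl rfl (Or.inl rfl)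
    obtain ⟨c, hc, hcc, hbot⟩ := exists_bottom htrans (hcrit.subset fun c hc => hc.1 : C.Finite)
      ⟨c₀, hc₀⟩ fun c hc => hahead c (hstable c hc.2.1 hc.2.2) hc.2.2 (Or.inr hc.2.1)
    obtain ⟨P, hP, hPc⟩ := hcov₁ c ⟨hc.1, hcc, fun v hcv hv => by
      have h1 := htrans _ _ _ hc.2.1 hcv
      have h2 := hv.trans hc.2.2
      -- A critical element is ahead of every `v` below `c`, and `c` is reachable from it.
      obtain ⟨c', hc', hvc'⟩ := hahead v (hstable v h1 h2) h2 (Or.inr h1)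
      exact htrans _ _ _ hvc' (hbot c' hc' (htrans _ _ _ hcv hvc')), by
      rw [hc.2.2, hrch₀]
      exact hu⟩
    exact ⟨P, Or.inl hP, c, hrole hc.2.1, hc.2.2.trans hrch₀, hPc⟩
  · obtain ⟨A, _, ⟨v, hv₀v, hrch, rfl⟩, hA⟩ := hS
    have hfut := hstable v hv₀v hrch
    obtain ⟨P, hP, hPv⟩ := hcov₂ v ⟨⟨(I.role_sub _ _ hv₀v).2, hstable.of_role htrans hv₀v hrch,
      hfut.symm ▸ ⟨v, hv₀v, hrch, rfl⟩, ⟨A, hA⟩, fun k hk hFk => hF ⟨k, hfut ▸ hk, hFk⟩⟩, by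
      rw [hrch, hrch₀]
      exact hu⟩
    exact ⟨P, Or.inr hP, v, hrole hv₀v, hrch.trans hrch₀, hPv⟩

/-! ### The inductive construction -/

theorem isBlock_ofFamily_unit {N U : Type*} (F : N) (r : U) (T : Set N) :
    IsBlock F (Rooted.ofFamily (fun _ : Unit => r) (fun _ => T) (fun _ _ => False) ()) := by
  by_cases hF : F ∈ T
  · refine Or.inr ⟨⟨?_, r, (), rfl, hF⟩, (), rfl, hF⟩
    rintro _ ⟨-, rfl⟩ _ ⟨-, rfl⟩
    exact .refl
  · refine Or.inl ⟨Or.inl ⟨⟨r, Set.range_const⟩, ?_⟩, ?_⟩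
    · rintro x y ⟨-, -, -, -, h⟩
      exact h
    · ext x
      simp only [Set.mem_empty_iff_false, iff_false]
      rintro ⟨_, _, h⟩
      exact hF h

/-- The pattern with root `r` for an element `u₀` and all those that agree with it, where the
patterns `M A`, for `A ∈ S`, are attached to the root. -/
theorem exists_isSmall_point {N U X : Type*} {F : N} {I : Labelled N U X} {b : ℕ} {u₀ r : U}
    (hu₀ : u₀ ∈ I.dom) {S : Set N} (hS : S.Finite) {M : N → Pattern N U}
    (hM : ∀ A ∈ S, (M A).IsSmall F I b)
    (hdisj : ∀ A ∈ S, ∀ B ∈ S, A ≠ B → Disjoint (M A).base.dom (M B).base.dom)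
    (hrM : ∀ A ∈ S, r ∉ (M A).base.dom)
    (henter : ∀ A ∈ S, ∃ w, I.role u₀ w ∧ (M A).sim (M A).base.root w)
    (hrch : ∀ A ∈ I.rch u₀, ∃ B ∈ S,
        A ∈ (M B).base.type (M B).base.root ∨ A ∈ (M B).base.rch (M B).base.root) :
    ∃ P : Pattern N U, P.IsSmall F I (1 + S.ncard * b) ∧ P.base.root = r ∧
      P.base.dom ⊆ {r} ∪ ⋃ A ∈ S, (M A).base.dom ∧ (∀ x, ¬ P.base.role x P.base.root) ∧
      ∀ u ∈ I.dom, I.type u = I.type u₀ → I.label u = I.label u₀ → I.rch u = I.rch u₀ →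
        (F ∈ I.type u → u = u₀) → (∀ A ∈ S, ∃ w, I.role u w ∧ (M A).sim (M A).base.root w) →
        P.sim P.base.root u := by
  obtain ⟨P, hP, h1, h2, h3, h4⟩ := exists_isSmall_attach (F := F) (I := I) (b := b)
    (c := fun _ : Unit => r) (fun _ _ _ => rfl) (isBlock_ofFamily_unit F r (I.type u₀))
    (fun _ u => u ∈ I.dom ∧ I.type u = I.type u₀ ∧ I.label u = I.label u₀ ∧ I.rch u = I.rch u₀ ∧
      (F ∈ I.type u → u = u₀) ∧ ∀ A ∈ S, ∃ w, I.role u w ∧ (M A).sim (M A).base.root w)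
    hS hM hdisj (fun A hA _ => hrM A hA) (fun h => h.1)
    (fun _ => ⟨u₀, hu₀, rfl, rfl, rfl, fun _ => rfl, henter⟩) (fun h => h.2.1.symm)
    (fun h h' => h.2.2.1.trans h'.2.2.1.symm)
    (fun _ hF _ _ _ h h' => (h.2.2.2.2.1 (h.2.1 ▸ hF)).trans (h'.2.2.2.2.1 (h'.2.1 ▸ hF)).symm)
    (fun _ h => h.elim) (fun h => h.2.2.2.2.2)
    (fun h A hA => Or.inr ⟨.refl, hrch A (h.2.2.2.1 ▸ hA)⟩)
  refine ⟨P, by simpa using hP, h1, by simpa using h2, h4 fun _ h => h, ?_⟩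
  exact fun u hu ha hb hc hd he => h3 u ⟨hu, ha, hb, hc, hd, he⟩

theorem HasCover.succ {N U X : Type*} {F : N} {I : Labelled N U X} {t b : ℕ}
    (h : HasCover F I t b) (htrans : I.IsTransitive) (hocc : I.occurring.Finite)
    (hcrit : (I.concept F).Finite) (hlabel : (I.label '' I.dom).Finite) :
    HasCover F I (t + 1) (1 + I.occurring.ncard + I.occurring.ncard * b) := by
  classical
  intro W hW r hr
  obtain ⟨𝓜, nm, hfam⟩ := h.exists_isCoverFamily hocc hW
  obtain ⟨𝓑, h𝓑fin, h𝓑, hblocks⟩ := hfam.exists_blocks htrans hocc hcrit hlabel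
  obtain ⟨𝓒, h𝓒fin, h𝓒⟩ := hfam.exists_finite_colour hocc hlabel
  let enterable : U → Set (Pattern N U) := fun u =>
    {P ∈ 𝓑 | ∃ v, I.role u v ∧ I.rch v = I.rch u ∧ P.sim P.base.root v}
  let key : U → _ := fun u => (colour I 𝓜 u, I.rch u, enterable u, I.concept F ∩ {u})
  have hkey : (key '' {u | u ∈ I.dom ∧ (I.rch u).ncard < t + 1}).Finite := by
    refine (h𝓒fin.prod (hocc.finite_subsets.prod (h𝓑fin.finite_subsets.prod
      hcrit.finite_subsets))).subset ?_
    rintro _ ⟨u, hu, rfl⟩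
    exact ⟨h𝓒 u hu.1, Interp.rch_subset_occurring u, Set.sep_subset _ _, Set.inter_subset_left⟩
  suffices hpoint : ∀ u₀ ∈ {u | u ∈ I.dom ∧ (I.rch u).ncard < t + 1}, ∃ M : Pattern N U,
      (M.IsSmall F I (1 + I.occurring.ncard + I.occurring.ncard * b) ∧
        M.base.root = r ∧ M.base.dom ⊆ insert r W ∧ ∀ x, ¬ M.base.role x M.base.root) ∧
      ∀ u ∈ {u | u ∈ I.dom ∧ (I.rch u).ncard < t + 1}, key u = key u₀ →
        M.sim M.base.root u by
    obtain ⟨𝓡, h𝓡fin, h𝓡, hcov⟩ := exists_finite_cover hkey hpoint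
    exact ⟨𝓡, h𝓡fin, h𝓡, fun w hw hlt => hcov w ⟨hw, hlt⟩⟩
  rintro u₀ ⟨hu₀, hlt⟩
  have hcritu : ∀ u, I.concept F ∩ {u} = I.concept F ∩ {u₀} → F ∈ I.type u → u = u₀ := by
    intro u hu hF
    have h1 : u ∈ I.concept F ∩ {u₀} := hu ▸ ⟨hF, rfl⟩
    exact h1.2
  rcases hblocks u₀ hlt with hav | ⟨B, hB, v, huv, hv, hsim⟩
  · have hM : ∀ A, ∃ M, A ∈ I.rch u₀ → (A, M) ∈ available I 𝓜 u₀ := by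
      intro A
      by_cases hA : A ∈ I.rch u₀
      · obtain ⟨M, hM⟩ := hav A hA
        exact ⟨M, fun _ => hM⟩
      · exact ⟨⟨Rooted.point u₀ ∅, fun _ _ => False⟩, fun h => absurd h hA⟩
    choose M hM using hM
    have hSocc : I.rch u₀ ⊆ I.occurring := Interp.rch_subset_occurring u₀
    obtain ⟨P, hP, hPr, hPdom, hPin, hPsim⟩ := exists_isSmall_point (r := r) hu₀
      (hocc.subset hSocc) (M := M) (fun A hA => hfam.small A (hSocc hA) _ (hM A hA).2.1)
      (fun A hA B hB hAB =>
        hfam.disj A (hSocc hA) B (hSocc hB) hAB _ (hM A hA).2.1 _ (hM B hB).2.1)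
      (fun A hA h => hr (hfam.sub A (hSocc hA) _ (hM A hA).2.1 h))
      (fun A hA => (hM A hA).2.2.2) (fun A hA => ⟨A, hA, Or.inl (hM A hA).2.2.1⟩)
    refine ⟨P, ⟨hP.mono ?_, hPr, hPdom.trans ?_, hPin⟩, fun u hu hkey => ?_⟩
    · have := Nat.mul_le_mul_right b (Set.ncard_le_ncard hSocc hocc)
      omega
    · rw [Set.insert_eq]
      exact Set.union_subset_union_right _
        (Set.iUnion₂_subset fun A hA => hfam.sub A (hSocc hA) _ (hM A hA).2.1)
    · simp only [key, Prod.mk.injEq] at hkey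
      obtain ⟨hcol, hrch, -, hcr⟩ := hkey
      refine hPsim u hu.1 (congrArg Prod.fst hcol) (congrArg (fun k => k.2.1) hcol) hrch
        (hcritu u hcr) fun A hA => ?_
      have hav' : available I 𝓜 u = available I 𝓜 u₀ := congrArg (fun k => k.2.2) hcol
      exact (hav' ▸ hM A hA : (A, M A) ∈ available I 𝓜 u).2.2.2
  · -- A single pattern `B` is attached, for which `F` serves as an arbitrary index.
    obtain ⟨hBsmall, hBW⟩ := h𝓑 B hB
    obtain ⟨P, hP, hPr, hPdom, hPin, hPsim⟩ := exists_isSmall_point (r := r) hu₀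
      (Set.finite_singleton F) (M := fun _ => B) (fun _ _ => hBsmall)
      (fun A hA A' hA' hne => absurd (hA.trans hA'.symm) hne) (fun _ _ h => hr (hBW h))
      (fun _ _ => ⟨v, huv, hsim⟩)
      (fun A hA => ⟨F, rfl, Or.inr (hBsmall.realizable.rch_sub hsim (hv.symm ▸ hA))⟩)
    refine ⟨P, ⟨hP.mono ?_, hPr, hPdom.trans ?_, hPin⟩, fun u hu hkey => ?_⟩
    · rw [Set.ncard_singleton]
      omega
    · rw [Set.insert_eq]
      exact Set.union_subset_union_right _ (Set.iUnion₂_subset fun _ _ => hBW)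
    · simp only [key, Prod.mk.injEq] at hkey
      obtain ⟨hcol, hrch, hent, hcr⟩ := hkey
      refine hPsim u hu.1 (congrArg Prod.fst hcol) (congrArg (fun k => k.2.1) hcol) hrch
        (hcritu u hcr) fun _ _ => ?_
      have hBu : B ∈ enterable u := hent ▸ ⟨hB, v, huv, hv, hsim⟩
      obtain ⟨-, w, h1, -, h2⟩ := hBu
      exact ⟨w, h1, h2⟩

theorem hasCover_pow {N U X : Type*} {F : N} {I : Labelled N U X}
    (htrans : I.IsTransitive) (hocc : I.occurring.Finite)
    (hcrit : (I.concept F).Finite) (hlabel : (I.label '' I.dom).Finite) (t : ℕ) :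
    HasCover F I (t + 1) ((I.occurring.ncard + 1) ^ (2 * t + 1)) := by
  have hmono : ∀ {t b b' : ℕ}, b ≤ b' → HasCover F I t b → HasCover F I t b' := by
    intro t b b' hb h W hW r hr
    obtain ⟨𝓜, h1, h2, h3⟩ := h W hW r hr
    exact ⟨𝓜, h1, fun M hM => ⟨(h2 M hM).1.mono hb, (h2 M hM).2⟩, h3⟩
  induction t with
  | zero =>
    have h0 : HasCover F I 0 0 := fun W _ r _ => ⟨∅, Set.finite_empty, by simp, by simp⟩
    refine hmono ?_ (h0.succ htrans hocc hcrit hlabel)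
    simp
    omega
  | succ t ih =>
    refine hmono ?_ (ih.succ htrans hocc hcrit hlabel)
    generalize I.occurring.ncard = l
    have h1 : l + 1 ≤ (l + 1) ^ (2 * t + 1) := Nat.le_self_pow (by omega) _
    calc 1 + l + l * (l + 1) ^ (2 * t + 1)
        ≤ (l + 1) ^ (2 * t + 1) + l * (l + 1) ^ (2 * t + 1) := by omega
      _ = (l + 1) ^ (2 * t + 1 + 1) := by ring
      _ ≤ (l + 1) ^ (2 * (t + 1) + 1) := Nat.pow_le_pow_right (by omega) (by omega)

end DL

/-- `F` is the concept name whose elements are the critical ones, and `U` is the (infinite)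
universe from which the elements of interpretations are taken. -/
theorem theorem1 {N U X : Type*} [Infinite U] (F : N) (I : DL.Labelled N U X)
    (htrans : I.IsTransitive)
    (hocc : I.occurring.Finite)
    (hcrit : (I.concept F).Finite)
    (hlabel : (I.label '' I.dom).Finite) :
    ∃ E : DL.Labelled N U X,
      E.root = I.root ∧
      DL.IsElementary F E.toRooted ∧
      E.dom.Finite ∧
      E.dom.ncard ≤ (I.occurring.ncard + 1) ^ (I.occurring.ncard + 1) ^ 2 ∧
      ∃ h, DL.IsStrongHom (E.quasiUnravelling F) I h := by
  obtain ⟨𝓜, -, h𝓜, hcov⟩ := DL.hasCover_pow (F := F) htrans hocc hcrit hlabel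
    I.occurring.ncard {I.root}ᶜ (Set.finite_singleton _).infinite_compl I.root (by simp)
  obtain ⟨M, hM, hsim⟩ := hcov I.root I.root_mem
    (Nat.lt_succ_of_le (Set.ncard_le_ncard (DL.Interp.rch_subset_occurring _) hocc))
  obtain ⟨hsmall, hroot, -, hin⟩ := h𝓜 M hM
  obtain ⟨label, h, hh⟩ := hsmall.realizable.exists_isStrongHom htrans hsim fun _ => hin
  refine ⟨⟨M.base, label⟩, hroot, hsmall.top.isElementary, hsmall.finite,
    hsmall.card_le.trans (Nat.pow_le_pow_right (by omega) ?_), h, hh⟩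
  nlinarith [Nat.zero_le (I.occurring.ncard)]
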